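/- Let $m\in\mathbb N$, let $U\subseteq\mathbb C^m$ be a non-empty connected open set, and let $\mathcal H$ be a function Hilbert space on $U$, that is, a complex Hilbert space consisting of holomorphic functions $f:U\to\mathbb C$ such that for every $z\in U$ the evaluation $f\mapsto f(z)$ is continuous on $\mathcal H$. Let $\phi:U\to\mathbb C$ be a non-constant multiplier for $\mathcal H$, that is, a non-constant function such that $\phi f\in\mathcal H$ for every $f\in\mathcal H$. If there are points $z\in U$ at which all functions in $\mathcal H$ vanish, assume in addition that $\phi$ is complex differentiable at these points; thus $\phi$ is holomorphic on $U$ (at all other points this is automatic). Let $M_\phi\in L(\mathcal H)$, $M_\phi f=\phi f$, be the (automatically continuous) multiplication operator, $M_\phi^\star$ its Hilbert space adjoint, and $$a=\inf_{z\in U}|\phi(z)|,\qquad b=\sup_{z\in U}|\phi(z)|,$$ with the conventions $0^{-1}=\infty$ and $\infty^{-1}=0$. Then the set of common hypercyclic vectors of the family $\{zM_\phi^\star: z\in\mathbb C,\ b^{-1}<|z|<a^{-1}\}$, that is, the set of all $x\in\mathcal H$ such that for each such $z$ the orbit $\{(zM_\phi^\star)^n x: n=0,1,2,\dots\}$ is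 dense in $\mathcal H$, is a dense $G_\delta$-subset of $\mathcal H$. -/

import Mathlib

open TopologicalSpace
open scoped ENNReal

/-- A complex function `f` on an open set `U ⊆ ℂᵐ` is holomorphic at the point `z ∈ U`: it is
complex differentiable there. The values of the extension outside the open set `U` are
irrelevant. -/
def HolAt {m : ℕ} {U : Opens (Fin m → ℂ)} (f : U → ℂ) (z : U) : Prop :=
  DifferentiableAt ℂ (Function.extend Subtype.val f 0) (z : Fin m → ℂ)

/-- A function Hilbert space on an open set `U ⊆ ℂᵐ`: a Hilbert space whose elements are
(identified with) complex functions on `U`, with continuous point evaluations (this is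
the content of `RKHS ℂ H U ℂ`), all of them holomorphic on `U`. -/
class FunctionHilbertSpace {m : ℕ} (U : Opens (Fin m → ℂ)) (H : Type*)
    [NormedAddCommGroup H] [InnerProductSpace ℂ H] [RKHS ℂ H U ℂ] : Prop where
  complete : CompleteSpace H
  holomorphic : ∀ (f : H) (z : U), HolAt (f : U → ℂ) z

instance FunctionHilbertSpace.instCompleteSpace {m : ℕ} (U : Opens (Fin m → ℂ)) (H : Type*)
    [NormedAddCommGroup H] [InnerProductSpace ℂ H] [RKHS ℂ H U ℂ]
    [h : FunctionHilbertSpace U H] : CompleteSpace H := h.complete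

section Multiplier

variable {X : Type*} {H : Type*} [NormedAddCommGroup H] [InnerProductSpace ℂ H] [RKHS ℂ H X ℂ]

/-- `φ` is a multiplier for `H`: `φ f ∈ H` for each `f ∈ H`. -/
def IsMultiplier (H : Type*) {X : Type*} [NormedAddCommGroup H] [InnerProductSpace ℂ H]
    [RKHS ℂ H X ℂ] (φ : X → ℂ) : Prop :=
  ∀ f : H, ∃ g : H, ∀ x : X, g x = φ x * f x

/-- The linear map `f ↦ φ f` on `H` given by a multiplier. -/
noncomputable def multiplierLinearMap {φ : X → ℂ} (hφ : IsMultiplier H φ) : H →ₗ[ℂ] H where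
  toFun f := (hφ f).choose
  map_add' f g := by
    apply RKHS.ext
    intro x
    rw [(hφ (f + g)).choose_spec x, RKHS.coe_add, RKHS.coe_add, Pi.add_apply, Pi.add_apply,
      (hφ f).choose_spec x, (hφ g).choose_spec x, mul_add]
  map_smul' c f := by
    apply RKHS.ext
    intro x
    rw [(hφ (c • f)).choose_spec x, RingHom.id_apply, RKHS.coe_smul, RKHS.coe_smul,
      Pi.smul_apply, Pi.smul_apply, (hφ f).choose_spec x, smul_eq_mul, smul_eq_mul]
    ring

theorem multiplierLinearMap_apply {φ : X → ℂ} (hφ : IsMultiplier H φ) (f : H) (x : X) :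
    multiplierLinearMap hφ f x = φ x * f x := (hφ f).choose_spec x

/-- The multiplication operator `M_φ f = φ f`; it is continuous by the closed graph theorem. -/
noncomputable def mulOp [CompleteSpace H] {φ : X → ℂ} (hφ : IsMultiplier H φ) : H →L[ℂ] H :=
  ⟨multiplierLinearMap hφ, by
    apply LinearMap.continuous_of_seq_closed_graph
    intro u f g hu hg
    apply RKHS.ext
    intro x
    have h1 := ((RKHS.continuous_eval (H := H) x).tendsto g).comp hg
    have h2 := (((RKHS.continuous_eval (H := H) x).tendsto f).comp hu).const_mul (φ x)
    rw [multiplierLinearMap_apply]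
    refine tendsto_nhds_unique h1 (h2.congr fun n => ?_)
    exact (multiplierLinearMap_apply hφ (u n) x).symm⟩

theorem mulOp_apply [CompleteSpace H] {φ : X → ℂ} (hφ : IsMultiplier H φ) (f : H) (x : X) :
    mulOp hφ f x = φ x * f x := multiplierLinearMap_apply hφ f x

/-- The adjoint multiplication operator: the Hilbert space adjoint of `M_φ`. -/
noncomputable def adjointMulOp [CompleteSpace H] {φ : X → ℂ} (hφ : IsMultiplier H φ) :
    H →L[ℂ] H :=
  ContinuousLinearMap.adjoint (mulOp hφ)

end Multiplier

section Hypercyclic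

variable {E : Type*} [AddCommGroup E] [Module ℂ E] [TopologicalSpace E]

/-- `x` is a hypercyclic vector for `T`: the orbit `{Tⁿ x : n = 0, 1, 2, …}` is dense. -/
def IsHypercyclicVector (T : E →L[ℂ] E) (x : E) : Prop :=
  Dense (Set.range fun n : ℕ => (T ^ n) x)

/-- The set of common hypercyclic vectors of a family of operators. -/
def commonHypercyclicVectors (F : Set (E →L[ℂ] E)) : Set E :=
  {x | ∀ T ∈ F, IsHypercyclicVector T x}

end Hypercyclic

/-! By Baire's theorem and Lindelöf's, it suffices to work locally: for each open `V ≠ ∅` and each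
admissible `z`, the vectors `x` for which every `w` near `z` has some `(wT)ⁿx ∈ V` must be dense,
where `T` is the adjoint of `M_φ`.

The main tool is a family of two-sided orbits. If `W : ℤ → E` satisfies `T (W n) = W (n+1)`, starts
near `v`, and `‖W n‖` is at most a constant times `exp (nτ)/n²`, then `a • W (-n)` is small and
`(wT)ⁿ` carries it near `v`, provided `|w| = exp (-τ)` and `a wⁿ` is close to 1. One vector has to
serve all `w` in an open set, so many such pieces are added: `x = u + ∑ₜ aₜ W_{θₜ}(-Nt)`, with `|aₜ|
= exp (N t σₜ)` and levels `σₜ = const + κ log t`. The function `t ↦ tσₜ` is convex with derivative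
`θₜ = σₜ + κ`. Its tangent inequality bounds every cross term by a constant times `1/(N²(j-t)²)`,
which is summable and small for large `N`. The logarithm varies so slowly that `σₜ` stays close
enough to a given level for many consecutive `t`, and a finite list of unimodular factors, repeated
periodically in `aₜ`, then corrects the argument of `w` (`exists_unimodular_correction`,
`exists_logarithmic_net`, `dense_setOf_forall_exists_smul_pow_mem`).

The orbits come from reproducing kernels. Where `log φ` is a local coordinate on a complex line,
evaluations form a holomorphic family `K_ζ` with `K_ζ ∘ M_φ = e^ζ K_ζ`. Integrating `e^{nζ} K_ζ`
over a vertical segment against a weight vanishing at its ends gives an orbit of the adjoint, and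
two integrations by parts give the decay `n⁻²` (`exists_twoSidedOrbitsNear_adjoint`). A function
orthogonal to all starting points of such orbits vanishes on an open set, hence is zero, so these
starting points are dense (`twoSidedOrbitsNear_adjointMulOp`). The start vector `u` is approximated
by kernels at points where `|φ|` is small. -/

open Filter Topology

/-! ### Reduction by Baire category -/

/-- If `z ↦ zT` reaches `V` locally uniformly on dense sets, common hypercyclicity is generic. -/
theorem isGδ_dense_commonHypercyclicVectors {E : Type*} [NormedAddCommGroup E] [NormedSpace ℂ E]
    [SecondCountableTopology E] [BaireSpace E] (T : E →L[ℂ] E) {A : Set ℂ} (hA : IsOpen A)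
    (h : ∀ V : Set E, IsOpen V → V.Nonempty → ∀ z ∈ A, ∃ O ∈ 𝓝 z,
      Dense {x : E | ∀ w ∈ O, ∃ n : ℕ, ((w • T) ^ n) x ∈ V}) :
    IsGδ (commonHypercyclicVectors {S : E →L[ℂ] E | ∃ z ∈ A, S = z • T}) ∧
    Dense (commonHypercyclicVectors {S : E →L[ℂ] E | ∃ z ∈ A, S = z • T}) := by
  -- The exponent may depend on `w`; compactness of `K` and the tube lemma still give one
  -- neighbourhood of `x` that works for all `w ∈ K`.
  have hopen : ∀ V : Set E, IsOpen V → ∀ K : Set ℂ, IsCompact K →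
      IsOpen {x : E | ∀ w ∈ K, ∃ n : ℕ, ((w • T) ^ n) x ∈ V} := by
    intro V hV K hK
    have hO : IsOpen {p : E × ℂ | ∃ n : ℕ, ((p.2 • T) ^ n) p.1 ∈ V} := by
      have : {p : E × ℂ | ∃ n : ℕ, ((p.2 • T) ^ n) p.1 ∈ V} =
          ⋃ n : ℕ, (fun p : E × ℂ => ((p.2 • T) ^ n) p.1) ⁻¹' V := by
        ext p; simp
      rw [this]
      refine isOpen_iUnion fun n => hV.preimage ?_
      simp only [smul_pow, _root_.smul_apply]
      fun_prop
    rw [isOpen_iff_mem_nhds]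
    intro x hx
    obtain ⟨u, v, hu, -, hxu, hKv, huv⟩ := generalized_tube_lemma (isCompact_singleton (x := x)) hK
      hO (by rintro ⟨y, w⟩ ⟨hy, hw⟩; obtain rfl : y = x := hy; exact hx w hw)
    exact Filter.mem_of_superset (hu.mem_nhds (hxu rfl))
      fun y hy w hw => huv (Set.mk_mem_prod hy (hKv hw))
  have hloc : ∀ V : Set E, IsOpen V → V.Nonempty → ∀ z ∈ A, ∃ K ∈ 𝓝 z, K ⊆ A ∧ IsCompact K ∧
      Dense {x : E | ∀ w ∈ K, ∃ n : ℕ, ((w • T) ^ n) x ∈ V} := by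
    intro V hV hne z hz
    obtain ⟨O, hO, hd⟩ := h V hV hne z hz
    obtain ⟨K, hK, hKO, hKc⟩ := local_compact_nhds (Filter.inter_mem hO (hA.mem_nhds hz))
    exact ⟨K, hK, fun w hw => (hKO hw).2, hKc, hd.mono fun x (hx : ∀ w ∈ O, _) w hw => hx w (hKO hw).1⟩
  have key : ∀ V : Set E, IsOpen V → V.Nonempty →
      IsGδ {x : E | ∀ w ∈ A, ∃ n : ℕ, ((w • T) ^ n) x ∈ V} ∧
      Dense {x : E | ∀ w ∈ A, ∃ n : ℕ, ((w • T) ^ n) x ∈ V} := by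
    intro V hVo hne
    choose! K hK hKA hKc hKd using hloc V hVo hne
    obtain ⟨t, htA, htc, hcov⟩ := countable_cover_nhdsWithin (s := A) (f := K)
      fun z hz => mem_nhdsWithin_of_mem_nhds (hK z hz)
    have heq : {x : E | ∀ w ∈ A, ∃ n : ℕ, ((w • T) ^ n) x ∈ V} =
        ⋂ z ∈ t, {x : E | ∀ w ∈ K z, ∃ n : ℕ, ((w • T) ^ n) x ∈ V} := by
      ext x
      simp only [Set.mem_ofPred_eq, Set.mem_iInter]
      constructor
      · exact fun hx z hz w hw => hx w (hKA z (htA hz) hw)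
      · intro hx w hw
        obtain ⟨z, hz, hwz⟩ := Set.mem_iUnion₂.1 (hcov hw)
        exact hx z hz w hwz
    rw [heq]
    exact ⟨IsGδ.biInter htc fun z hz => (hopen V hVo _ (hKc z (htA hz))).isGδ,
      dense_biInter_of_isOpen (fun z hz => hopen V hVo _ (hKc z (htA hz))) htc
        fun z hz => hKd z (htA hz)⟩
  have heq : commonHypercyclicVectors {S : E →L[ℂ] E | ∃ z ∈ A, S = z • T} =
      ⋂ V ∈ countableBasis E, {x : E | ∀ w ∈ A, ∃ n : ℕ, ((w • T) ^ n) x ∈ V} := by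
    ext x
    simp only [commonHypercyclicVectors, IsHypercyclicVector, Set.mem_ofPred_eq, Set.mem_iInter]
    constructor
    · intro hx V hV w hw
      obtain ⟨_, hy, n, rfl⟩ := (hx (w • T) ⟨w, hw, rfl⟩).inter_open_nonempty V
        (isOpen_of_mem_countableBasis hV) (nonempty_of_mem_countableBasis hV)
      exact ⟨n, hy⟩
    · rintro hx _ ⟨w, hw, rfl⟩
      refine (isBasis_countableBasis E).dense_iff.2 fun V hV _ => ?_
      obtain ⟨n, hn⟩ := hx V hV w hw
      exact ⟨_, hn, n, rfl⟩
  rw [heq]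
  refine ⟨IsGδ.biInter (countable_countableBasis E) fun V hV =>
    (key V (isOpen_of_mem_countableBasis hV) (nonempty_of_mem_countableBasis hV)).1, ?_⟩
  exact dense_biInter_of_Gδ (fun V hV =>
      (key V
        (isOpen_of_mem_countableBasis hV) (nonempty_of_mem_countableBasis hV)).1)
    (countable_countableBasis E) fun V hV =>
      (key V
        (isOpen_of_mem_countableBasis hV) (nonempty_of_mem_countableBasis hV)).2

/-! ### Phase correction and the logarithmic net -/

/-- Finitely many unimodular phases that correct every geometric progression of unimodular
numbers at one of its terms. -/
theorem exists_unimodular_correction {δ : ℝ} (hδ : 0 < δ) :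
    ∃ (k : ℕ) (c : ℕ → ℂ), (∀ i, ‖c i‖ = 1) ∧ ∀ ψ w : ℂ, ‖ψ‖ = 1 → ‖w‖ = 1 →
      ∃ i < k, ‖w * ψ ^ i * c i - 1‖ < δ := by
  suffices H : ∃ (k : ℕ) (c : ℕ → ℂ), (∀ i, ‖c i‖ = 1) ∧ ∀ ψ ∈ Metric.sphere (0 : ℂ) 1,
      ‖ψ‖ = 1 → ∀ w : ℂ, ‖w‖ = 1 → ∃ i < k, ‖w * ψ ^ i * c i - 1‖ < δ by
    obtain ⟨k, c, hc, h⟩ := H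
    exact ⟨k, c, hc, fun ψ w hψ hw => h ψ (by simpa using hψ) hψ w hw⟩
  -- Compactness in `ψ`. Near a fixed `ψ₀` finitely many powers `ψ ^ i` are almost `ψ₀ ^ i`, so a
  -- finite net of the circle, twisted by `(ψ₀ ^ i)⁻¹`, handles every `w`. For a union the two lists
  -- are concatenated.
  refine (isCompact_sphere (0 : ℂ) 1).induction_on (p := fun S => ∃ (k : ℕ) (c : ℕ → ℂ),
    (∀ i, ‖c i‖ = 1) ∧ ∀ ψ ∈ S, ‖ψ‖ = 1 → ∀ w : ℂ, ‖w‖ = 1 →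
      ∃ i < k, ‖w * ψ ^ i * c i - 1‖ < δ) ?_ ?_ ?_ ?_
  · exact ⟨0, fun _ => 1, by simp, by simp⟩
  · rintro s t hst ⟨k, c, hc, h⟩
    exact ⟨k, c, hc, fun ψ hψ => h ψ (hst hψ)⟩
  · rintro s t ⟨k, c, hc, h⟩ ⟨l, d, hd, h'⟩
    refine ⟨k + l, fun i => if i < k then c i else d (i - k), fun i => ?_, ?_⟩
    · dsimp only; split_ifs <;> simp [hc, hd]
    · rintro ψ (hψ | hψ) h1 w hw
      · obtain ⟨i, hi, hlt⟩ := h ψ hψ h1 w hw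
        exact ⟨i, by omega, by simpa [hi] using hlt⟩
      -- The second list starts at index `k`, so the offset `ψ ^ k` is absorbed into `w`.
      · obtain ⟨i, hi, hlt⟩ := h' ψ hψ h1 (w * ψ ^ k) (by simp [hw, h1])
        refine ⟨k + i, by omega, ?_⟩
        simpa [pow_add, mul_assoc] using hlt
  · intro ψ₀ hψ₀
    have h0 : ‖ψ₀‖ = 1 := by simpa using hψ₀
    have hψ0 : ψ₀ ≠ 0 := by intro h; simp [h] at h0
    -- a finite net of the circle
    obtain ⟨s', hs's, hs', hcov'⟩ : ∃ s' : Set ℂ, s' ⊆ Metric.sphere (0 : ℂ) 1 ∧ s'.Finite ∧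
        ∀ w ∈ Metric.sphere (0 : ℂ) 1, ∃ e ∈ s', dist w e < δ / 2 := by
      have hfin := (isCompact_sphere (0 : ℂ) 1).elim_nhds_subcover (fun x => Metric.ball x (δ / 2))
        (fun x _ => Metric.ball_mem_nhds x (by positivity))
      obtain ⟨t, ht, hc⟩ := hfin
      exact ⟨t, ht, t.finite_toSet, fun w hw => by simpa using hc hw⟩
    have := hs'.fintype
    let e := Fintype.equivFin s'
    refine ⟨{ψ | ∀ i < Fintype.card s', ‖ψ ^ i - ψ₀ ^ i‖ < δ / 2}, ?_, Fintype.card s',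
      fun i => if h : i < Fintype.card s' then ((e.symm ⟨i, h⟩ : s') : ℂ) * (ψ₀ ^ i)⁻¹ else 1,
      fun i => ?_, ?_⟩
    · refine mem_nhdsWithin_of_mem_nhds ?_
      have : ∀ᶠ ψ in 𝓝 ψ₀, ∀ i ∈ Finset.range (Fintype.card s'), ‖ψ ^ i - ψ₀ ^ i‖ < δ / 2 := by
        rw [Filter.eventually_all_finset]
        intro i _
        have : Tendsto (fun ψ : ℂ => ‖ψ ^ i - ψ₀ ^ i‖) (𝓝 ψ₀) (𝓝 0) := by
          have : ContinuousAt (fun ψ : ℂ => ‖ψ ^ i - ψ₀ ^ i‖) ψ₀ := by fun_prop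
          simpa [ContinuousAt] using this
        exact this.eventually (gt_mem_nhds (by positivity))
      filter_upwards [this] with ψ h i hi using h i (Finset.mem_range.2 hi)
    · dsimp only
      split_ifs with h
      · have := hs's (e.symm ⟨i, h⟩).2
        simp only [mem_sphere_zero_iff_norm] at this
        simp [this, h0]
      · simp
    · intro ψ hψ _ w hw
      have hw0 : w ≠ 0 := by intro h; simp [h] at hw
      obtain ⟨q, hq, hd⟩ := hcov' w⁻¹ (by simp [hw])
      have hq1 : ‖q‖ = 1 := by simpa using hs's hq
      refine ⟨(e ⟨q, hq⟩).val, (e ⟨q, hq⟩).2, ?_⟩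
      have hlt := hψ (e ⟨q, hq⟩).val (e ⟨q, hq⟩).2
      set i : ℕ := (e ⟨q, hq⟩ : Fin _).val with hi
      have : (e.symm ⟨i, (e ⟨q, hq⟩).2⟩ : s') = ⟨q, hq⟩ := by simp [hi]
      dsimp only
      rw [dif_pos (e ⟨q, hq⟩).2, this]
      have hp : ψ₀ ^ i ≠ 0 := pow_ne_zero _ hψ0
      have key : w * ψ ^ i * (q * (ψ₀ ^ i)⁻¹) - 1 =
          w * q * (ψ₀ ^ i)⁻¹ * (ψ ^ i - ψ₀ ^ i) + w * (q - w⁻¹) := by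
        field_simp; ring
      calc _ ≤ ‖w * q * (ψ₀ ^ i)⁻¹ * (ψ ^ i - ψ₀ ^ i)‖ + ‖w * (q - w⁻¹)‖ := by
            rw [key]; exact norm_add_le _ _
        _ = ‖ψ ^ i - ψ₀ ^ i‖ + ‖q - w⁻¹‖ := by simp [hw, hq1, h0]
        _ < δ / 2 + δ / 2 := by
            rw [dist_comm, dist_eq_norm] at hd; gcongr
        _ = δ := by ring

/-- The tangent inequality for the convex function `x ↦ x log x` on `ℕ`. -/
theorem natCast_mul_log_ge (j t : ℕ) (ht : 1 ≤ t) :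
    (t : ℝ) * Real.log t + ((j : ℝ) - t) * (Real.log t + 1) ≤ j * Real.log j := by
  have ht' : (0 : ℝ) < t := by exact_mod_cast ht
  rcases Nat.eq_zero_or_pos j with rfl | hj
  · simp; linarith
  · have hj' : (0 : ℝ) < j := by exact_mod_cast hj
    have h := Real.log_le_sub_one_of_pos (div_pos ht' hj')
    rw [Real.log_div ht'.ne' hj'.ne'] at h
    have h2 : (j : ℝ) * (Real.log t - Real.log j) ≤ j * (t / j - 1) :=
      mul_le_mul_of_nonneg_left h hj'.le
    have h3 : (j : ℝ) * (t / j - 1) = t - j := by field_simp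
    nlinarith

/-- A logarithmic net whose points stay close to each given level for `l` consecutive times. -/
theorem exists_logarithmic_net {δ η : ℝ} (hδ : 0 < δ) (hη : 0 < η) (N l : ℕ) :
    ∃ (κ : ℝ) (M : ℕ), 0 < κ ∧ κ ≤ η ∧ (∀ t ≤ M, 1 ≤ t → κ * Real.log t ≤ 5 * η) ∧
      ∀ s, 0 ≤ s → s ≤ 3 * η → ∃ t₀ ≥ 1, ∀ i < l, t₀ + i ≤ M ∧
        |((N * (t₀ + i) : ℕ) : ℝ) * (κ * Real.log ((t₀ + i : ℕ) : ℝ) - s)| ≤ δ := by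
  -- The bound `η / (l + 1)` leaves room for the whole window below level `5 * η`; the last bound
  -- controls the error, which is at most `N κ (l + 1) (l + 2)`.
  set κ : ℝ := min (min η (η / (l + 1))) (δ / ((N + 1) * ((l + 1) * (l + 2)))) with hκ
  have hκ0 : 0 < κ := by
    refine lt_min (lt_min hη (by positivity)) (by positivity)
  have hκ1 : κ ≤ η := (min_le_left _ _).trans (min_le_left _ _)
  have hκ2 : κ * (l + 1) ≤ η := by
    have : κ ≤ η / (l + 1) := (min_le_left _ _).trans (min_le_right _ _)
    rwa [le_div_iff₀ (by positivity)] at this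
  have hκ3 : κ * ((N + 1) * ((l + 1) * (l + 2))) ≤ δ := by
    have : κ ≤ δ / ((N + 1) * ((l + 1) * (l + 2))) := min_le_right _ _
    rwa [le_div_iff₀ (by positivity)] at this
  refine ⟨κ, ⌊Real.exp (5 * η / κ)⌋₊, hκ0, hκ1, fun t ht h1 => ?_, fun s hs0 hs => ?_⟩
  · have h1' : (0 : ℝ) < t := by exact_mod_cast h1
    have h2 : (t : ℝ) ≤ Real.exp (5 * η / κ) := (Nat.le_floor_iff (by positivity)).1 ht
    have h3 : Real.log t ≤ 5 * η / κ := (Real.log_le_iff_le_exp h1').2 h2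
    rw [le_div_iff₀ hκ0] at h3
    linarith
  · set Θ : ℝ := Real.exp (s / κ) with hΘ
    have hΘ1 : 1 ≤ Θ := Real.one_le_exp (by positivity)
    have hlog : κ * Real.log Θ = s := by rw [hΘ, Real.log_exp]; field_simp
    have hf1 : (⌊Θ⌋₊ : ℝ) ≤ Θ := Nat.floor_le (by positivity)
    have hf2 : Θ < ⌊Θ⌋₊ + 1 := Nat.lt_floor_add_one Θ
    have hf3 : 1 ≤ ⌊Θ⌋₊ := Nat.le_floor (by simpa using hΘ1)
    refine ⟨⌊Θ⌋₊, hf3, fun i hi => ⟨?_, ?_⟩⟩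
    · rw [Nat.le_floor_iff (by positivity)]
      have hil : (i : ℝ) ≤ l := by exact_mod_cast hi.le
      have e1 : Θ ≤ Real.exp (3 * η / κ) := by
        rw [hΘ]; gcongr
      have e2 : (1 : ℝ) + l ≤ Real.exp (2 * η / κ) := by
        have : (l : ℝ) ≤ 2 * η / κ := by
          rw [le_div_iff₀ hκ0]; nlinarith
        linarith [Real.add_one_le_exp (2 * η / κ)]
      calc ((⌊Θ⌋₊ + i : ℕ) : ℝ) ≤ Θ + l := by push_cast; linarith
        _ ≤ Θ * (1 + l) := by nlinarith [Nat.cast_nonneg (α := ℝ) l]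
        _ ≤ Real.exp (3 * η / κ) * Real.exp (2 * η / κ) := by gcongr
        _ = _ := by rw [← Real.exp_add]; congr 1; ring
    · set t := ⌊Θ⌋₊ + i with ht
      have hil : (i : ℝ) + 1 ≤ l := by exact_mod_cast hi
      have htc : (t : ℝ) = ⌊Θ⌋₊ + i := by rw [ht]; push_cast; ring
      have ht1 : (1 : ℝ) ≤ t := by
        have : 1 ≤ t := by omega
        exact_mod_cast this
      have hΘ0 : 0 < Θ := by positivity
      have ht0 : (0 : ℝ) < t := by linarith
      -- The logarithm has slope about `1 / t`, so the factor `t` cancels: the bound depends only on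
      -- the window length, not on the level or on `κ`.
      have hb : (t : ℝ) * |Real.log t - Real.log Θ| ≤ (l + 1) * (l + 2) := by
        rcases le_total Θ t with h | h
        · have hl : Real.log Θ ≤ Real.log t := Real.log_le_log hΘ0 h
          have := Real.log_le_sub_one_of_pos (div_pos ht0 hΘ0)
          rw [Real.log_div ht0.ne' hΘ0.ne'] at this
          rw [abs_of_nonneg (by linarith)]
          have h5 : (t : ℝ) / Θ ≤ l + 1 := by
            rw [div_le_iff₀ hΘ0]; nlinarith
          have h6 : (t : ℝ) / Θ - 1 = (t - Θ) / Θ := by field_simp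
          calc (t : ℝ) * (Real.log t - Real.log Θ) ≤ t * ((t - Θ) / Θ) := by
                rw [← h6]; gcongr
            _ = t / Θ * (t - Θ) := by ring
            _ ≤ (l + 1) * (l + 2) := by
                gcongr
                linarith
        · have hl : Real.log t ≤ Real.log Θ := Real.log_le_log ht0 h
          have := Real.log_le_sub_one_of_pos (div_pos hΘ0 ht0)
          rw [Real.log_div hΘ0.ne' ht0.ne'] at this
          rw [abs_of_nonpos (by linarith)]
          have h6 : (t : ℝ) * (Θ / t - 1) = Θ - t := by field_simp
          calc (t : ℝ) * -(Real.log t - Real.log Θ) ≤ t * (Θ / t - 1) := by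
                exact mul_le_mul_of_nonneg_left (by linarith) ht0.le
            _ = Θ - t := h6
            _ ≤ (l + 1) * (l + 2) := by nlinarith [Nat.cast_nonneg (α := ℝ) l, Nat.cast_nonneg (α := ℝ) i]
      have e : ((N * t : ℕ) : ℝ) * (κ * Real.log (t : ℝ) - s) =
          N * κ * (t * (Real.log t - Real.log Θ)) := by
        rw [← hlog]; push_cast; ring
      rw [e, abs_mul, abs_of_nonneg (by positivity : (0 : ℝ) ≤ N * κ), abs_mul,
        abs_of_pos ht0]
      calc (N : ℝ) * κ * (t * |Real.log t - Real.log Θ|) ≤ (N + 1) * κ * ((l + 1) * (l + 2)) := by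
            gcongr; linarith
        _ ≤ δ := by linarith

/-! ### A criterion for common hypercyclicity through two-sided orbits -/

section Criterion

variable {E : Type*} [NormedAddCommGroup E] [NormedSpace ℂ E]

/-- For each radius `exp τ` with `τ` near `τ₀` there is a two-sided orbit of `T` that starts near
`v` and, scaled by that radius, decays quadratically in both directions. -/
def TwoSidedOrbitsNear (T : E →L[ℂ] E) (τ₀ : ℝ) (v : E) : Prop :=
  ∀ ε > 0, ∃ η > 0, ∃ (C : ℝ) (W : ℝ → ℤ → E), ∀ τ, |τ - τ₀| < η → ‖W τ 0 - v‖ < ε ∧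
    ∀ n : ℤ, T (W τ n) = W τ (n + 1) ∧ ‖W τ n‖ * (n : ℝ) ^ 2 ≤ C * Real.exp (n * τ)

theorem pow_apply_twoSidedOrbit {T : E →L[ℂ] E} {w : ℤ → E} (h : ∀ n, T (w n) = w (n + 1))
    (n : ℕ) (m : ℤ) : (T ^ n) (w m) = w (m + n) := by
  induction n with
  | zero => simp
  | succ n ih =>
    rw [pow_succ', mul_apply_eq_comp, ih, h]
    push_cast
    ring_nf

theorem sum_one_div_sub_sq_le (S : Finset ℕ) (j : ℕ) :
    ∑ t ∈ S, 1 / ((j : ℝ) - t) ^ 2 ≤ ∑' n : ℤ, 1 / (n : ℝ) ^ 2 := by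
  -- The terms with `n = 0` or `t = j` are `1 / 0 = 0` and do no harm.
  have hs : Summable fun n : ℤ => 1 / (n : ℝ) ^ 2 := Real.summable_one_div_int_pow.2 (by norm_num)
  have hinj : Function.Injective fun t : ℕ => (j : ℤ) - t := fun a b h => by
    simpa using h
  have := hs.sum_le_tsum (S.image fun t : ℕ => (j : ℤ) - t) fun _ _ => by positivity
  rw [Finset.sum_image hinj.injOn] at this
  simpa using this

theorem norm_exp_mul_sub_one_le {x δ : ℝ} {p : ℂ} (hδ : δ ≤ 1) (hx : |x| ≤ δ) (hp : ‖p - 1‖ ≤ δ) :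
    ‖(Real.exp x : ℂ) * p - 1‖ ≤ 5 * δ := by
  have h0 : 0 ≤ δ := (abs_nonneg _).trans hx
  have h1 : |Real.exp x - 1| ≤ 2 * |x| := Real.abs_exp_sub_one_le (hx.trans hδ)
  have h2 : Real.exp x ≤ 3 := by linarith [abs_le.1 h1]
  have e : (Real.exp x : ℂ) * p - 1 = (Real.exp x : ℂ) * (p - 1) + ((Real.exp x - 1 : ℝ) : ℂ) := by
    push_cast; ring
  rw [e]
  refine (norm_add_le _ _).trans ?_
  rw [norm_mul, Complex.norm_real, Complex.norm_real, Real.norm_eq_abs, Real.norm_eq_abs,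
    abs_of_pos (Real.exp_pos x)]
  nlinarith [norm_nonneg (p - 1), Real.exp_pos x]

/-- The approximant is `u` plus blocks `a t • W (θ t) (-N t)`. At time `N j` the block `j` lands
near `v`, while the others are small by convexity of `t ↦ t σ t`. Time `0` obeys the same estimate,
which keeps the vector near `u`. The orbit of `u` itself dies out since `α < τ₀`. -/
theorem dense_setOf_forall_exists_smul_pow_mem (T : E →L[ℂ] E) {τ₀ : ℝ}
    (h : ∀ v, TwoSidedOrbitsNear T τ₀ v) {D : Set E} (hD : Dense D) {α : ℝ} (hα : α < τ₀)
    (hu : ∀ u ∈ D, ∃ C : ℝ, ∀ n : ℕ, ‖(T ^ n) u‖ ≤ C * Real.exp (n * α))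
    {V : Set E} (hV : IsOpen V) (hne : V.Nonempty) :
    ∃ η > 0, Dense {x : E | ∀ z : ℂ, z ≠ 0 → |Real.log ‖z‖ + τ₀| < η →
      ∃ n : ℕ, ((z • T) ^ n) x ∈ V} := by
  obtain ⟨v, hv⟩ := hne
  obtain ⟨ε, hε, hball⟩ := Metric.isOpen_iff.1 hV v hv
  obtain ⟨η₀, hη₀, C₀, W, hW⟩ := h v (ε / 4) (by positivity)
  set C := max C₀ 0 with hC
  have hC0 : 0 ≤ C := le_max_right _ _
  set η := min η₀ (τ₀ - α) / 6 with hη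
  have hηpos : 0 < η := by have := lt_min hη₀ (sub_pos.2 hα); positivity
  have hη1 : 6 * η ≤ η₀ := by have := min_le_left η₀ (τ₀ - α); linarith
  have hη2 : 6 * η ≤ τ₀ - α := by have := min_le_right η₀ (τ₀ - α); linarith
  refine ⟨η, hηpos, Metric.dense_iff.2 fun x₀ r hr => ?_⟩
  obtain ⟨u, huD, hux⟩ := hD.exists_dist_lt x₀ (half_pos hr)
  obtain ⟨Cu, hCu⟩ := hu u huD
  -- The main block is off by at most `5 * δ * (‖v‖ + ε)` plus `ε / 4`; the factor `24 > 20` makes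
  -- the total strictly less than `ε / 2`.
  set δ := min 1 (ε / (24 * (‖v‖ + ε))) with hδ
  have hδ0 : 0 < δ := lt_min one_pos (by positivity)
  have hδ1 : δ ≤ 1 := min_le_left _ _
  have hδ2 : 24 * (δ * (‖v‖ + ε)) ≤ ε := by
    have : δ ≤ ε / (24 * (‖v‖ + ε)) := min_le_right _ _
    rw [le_div_iff₀ (by positivity)] at this
    linarith
  obtain ⟨k, c, hc, hphase⟩ := exists_unimodular_correction hδ0
  have hk : 0 < k := by
    obtain ⟨i, hi, -⟩ := hphase 1 1 (by simp) (by simp)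
    omega
  set B := ∑' n : ℤ, 1 / (n : ℝ) ^ 2 with hB
  obtain ⟨N, hN1, hNB, hNu⟩ : ∃ N : ℕ, 1 ≤ N ∧
      Real.exp 1 * (C / (N : ℝ) ^ 2 * B) < min (ε / 4) (r / 2) ∧
      |Cu| * Real.exp (-(N * η)) < ε / 4 := by
    have l1 : Tendsto (fun N : ℕ => Real.exp 1 * (C / (N : ℝ) ^ 2 * B)) atTop (𝓝 0) := by
      have : Tendsto (fun N : ℕ => C / (N : ℝ) ^ 2) atTop (𝓝 0) :=
        tendsto_const_nhds.div_atTop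
          ((tendsto_pow_atTop two_ne_zero).comp tendsto_natCast_atTop_atTop)
      simpa using (this.mul_const B).const_mul (Real.exp 1)
    have l2 : Tendsto (fun N : ℕ => |Cu| * Real.exp (-(N * η))) atTop (𝓝 0) := by
      have : Tendsto (fun N : ℕ => Real.exp (-(N * η))) atTop (𝓝 0) :=
        Real.tendsto_exp_neg_atTop_nhds_zero.comp
          (tendsto_natCast_atTop_atTop.atTop_mul_const hηpos)
      simpa using this.const_mul |Cu|
    exact ((eventually_ge_atTop 1).and ((l1.eventually (gt_mem_nhds (by positivity))).and
      (l2.eventually (gt_mem_nhds (by positivity))))).exists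
  have hN0 : (0 : ℝ) < N := by exact_mod_cast hN1
  -- A window of length `2 * k` contains a full period of `k` indices starting at a multiple of `k`.
  obtain ⟨κ, M, hκ0, hκη, hM, hnet⟩ := exists_logarithmic_net hδ0 hηpos N (2 * k)
  let σ : ℕ → ℝ := fun t => τ₀ - 2 * η + κ * Real.log t
  -- `θ t` is the derivative of `t ↦ t * σ t`, not `σ t` itself: this choice makes the exponent in
  -- `h3` nonpositive for every `j`.
  let θ : ℕ → ℝ := fun t => σ t + κ
  have hθ : ∀ t ∈ Finset.Icc 1 M, |θ t - τ₀| < η₀ := by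
    intro t ht
    rw [Finset.mem_Icc] at ht
    have h1 := hM t ht.2 ht.1
    have h2 : 0 ≤ κ * Real.log t := mul_nonneg hκ0.le (Real.log_natCast_nonneg t)
    simp only [θ, σ]
    rw [abs_lt]
    constructor <;> linarith
  have hcross : ∀ t ∈ Finset.Icc 1 M, ∀ j : ℕ, j ≠ t →
      Real.exp (N * t * σ t - N * j * σ j) * ‖W (θ t) (N * ((j : ℤ) - t))‖ ≤
        C / (N : ℝ) ^ 2 * (1 / ((j : ℝ) - t) ^ 2) := by
    intro t ht j hj
    have hjt : ((j : ℝ) - t) ≠ 0 := sub_ne_zero.2 (by exact_mod_cast hj)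
    have h1 := ((hW (θ t) (hθ t ht)).2 (N * ((j : ℤ) - t))).2
    push_cast at h1
    have hC' : C₀ * Real.exp (N * ((j : ℝ) - t) * θ t) ≤ C * Real.exp (N * ((j : ℝ) - t) * θ t) := by
      gcongr; exact le_max_left _ _
    have h2 := natCast_mul_log_ge j t (Finset.mem_Icc.1 ht).1
    have h3 : N * t * σ t - N * j * σ j + N * ((j : ℝ) - t) * θ t ≤ 0 := by
      simp only [θ, σ]
      have : (N : ℝ) * κ * ((t : ℝ) * Real.log t + ((j : ℝ) - t) * (Real.log t + 1) -
          j * Real.log j) ≤ 0 := mul_nonpos_of_nonneg_of_nonpos (by positivity) (by linarith)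
      linarith
    have h4 : Real.exp (N * t * σ t - N * j * σ j) * Real.exp (N * ((j : ℝ) - t) * θ t) ≤ 1 := by
      rw [← Real.exp_add]; exact Real.exp_le_one_iff.2 h3
    rw [div_mul_div_comm, mul_one, le_div_iff₀ (by positivity), ← mul_pow, mul_assoc]
    calc _ ≤ Real.exp (N * t * σ t - N * j * σ j) * (C * Real.exp (N * ((j : ℝ) - t) * θ t)) := by
          exact mul_le_mul_of_nonneg_left (h1.trans hC') (Real.exp_pos _).le
      _ = C * (Real.exp (N * t * σ t - N * j * σ j) * Real.exp (N * ((j : ℝ) - t) * θ t)) := by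
          ring
      _ ≤ C := mul_le_of_le_one_right hC0 h4
  let a : ℕ → ℂ := fun t => c (t % k) * (Real.exp (N * t * σ t) : ℂ)
  have ha : ∀ t, ‖a t‖ = Real.exp (N * t * σ t) := by
    intro t
    simp only [a, norm_mul, hc, Complex.norm_real, Real.norm_eq_abs, Real.abs_exp, one_mul]
  refine ⟨u + ∑ t ∈ Finset.Icc 1 M, a t • W (θ t) (N * ((0 : ℕ) - (t : ℤ))), ?_, ?_⟩
  · rw [Metric.mem_ball, dist_eq_norm]
    have hsum : ‖∑ t ∈ Finset.Icc 1 M, a t • W (θ t) (N * ((0 : ℕ) - (t : ℤ)))‖ ≤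
        C / (N : ℝ) ^ 2 * B := by
      refine (norm_sum_le _ _).trans ?_
      calc _ ≤ ∑ t ∈ Finset.Icc 1 M, C / (N : ℝ) ^ 2 * (1 / (((0 : ℕ) : ℝ) - t) ^ 2) := by
            refine Finset.sum_le_sum fun t ht => ?_
            have := hcross t ht 0 (by have := (Finset.mem_Icc.1 ht).1; omega)
            rw [norm_smul, ha]
            simpa using this
        _ ≤ _ := by
            rw [← Finset.mul_sum]
            gcongr
            exact sum_one_div_sub_sq_le _ 0
    have hB0 : 0 ≤ C / (N : ℝ) ^ 2 * B := (norm_nonneg _).trans hsum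
    have h1 : C / (N : ℝ) ^ 2 * B < r / 2 := by
      refine lt_of_le_of_lt ?_ (hNB.trans_le (min_le_right _ _))
      exact le_mul_of_one_le_left hB0 (Real.one_le_exp zero_le_one)
    calc _ = ‖(u - x₀) + ∑ t ∈ Finset.Icc 1 M, a t • W (θ t) (N * ((0 : ℕ) - (t : ℤ)))‖ := by
          congr 1; abel
      _ ≤ ‖u - x₀‖ + C / (N : ℝ) ^ 2 * B := (norm_add_le _ _).trans (by gcongr)
      _ < r / 2 + r / 2 := by
          rw [dist_comm, dist_eq_norm] at hux; gcongr
      _ = r := by ring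
  · intro z hz hzη
    have hz0 : 0 < ‖z‖ := norm_pos_iff.2 hz
    set τ := -Real.log ‖z‖ with hτ
    have hnz : ‖z‖ = Real.exp (-τ) := by rw [hτ, neg_neg, Real.exp_log hz0]
    have hτ1 : |τ₀ - τ| < η := by rw [hτ, sub_neg_eq_add, add_comm]; exact hzη
    rw [abs_lt] at hτ1
    -- The levels start `2 * η` below `τ₀`, so the height of `τ` above the lowest level lies between
    -- `η` and `3 * η`.
    obtain ⟨t₀, ht₀, hblock⟩ := hnet (τ - (τ₀ - 2 * η)) (by linarith) (by linarith)
    set ω : ℂ := z / ‖z‖ with hω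
    have hω1 : ‖ω‖ = 1 := by rw [hω, norm_div, Complex.norm_real, norm_norm, div_self hz0.ne']
    have hzω : z = (Real.exp (-τ) : ℂ) * ω := by
      rw [hω, ← hnz, mul_div_cancel₀]
      exact_mod_cast hz0.ne'
    set t₁ := k * (t₀ / k + 1) with ht₁
    have ht₁l : t₀ < t₁ := Nat.lt_mul_div_succ t₀ hk
    have ht₁u : t₁ ≤ t₀ + k := by
      have := Nat.mul_div_le t₀ k
      rw [ht₁, mul_add, mul_one]; omega
    -- As `k` divides `t₁`, the index `t₁ + i` carries the factor `c i`, and `z ^ (N * (t₁ + i))`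
    -- has phase `ω ^ (N * t₁) * (ω ^ N) ^ i`.
    obtain ⟨i, hik, hi⟩ := hphase (ω ^ N) (ω ^ (N * t₁)) (by simp [hω1]) (by simp [hω1])
    set j := t₁ + i with hj
    obtain ⟨hjM, hjδ⟩ := hblock (t₁ - t₀ + i) (by omega)
    have hjeq : t₀ + (t₁ - t₀ + i) = j := by omega
    rw [hjeq] at hjM hjδ
    have hj1 : 1 ≤ j := by omega
    have hjmem : j ∈ Finset.Icc 1 M := Finset.mem_Icc.2 ⟨hj1, hjM⟩
    have hjmod : j % k = i := by
      rw [hj, ht₁, Nat.mul_add_mod, Nat.mod_eq_of_lt hik]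
    have hjσ : |N * j * (σ j - τ)| ≤ δ := by
      have : (N : ℝ) * j * (σ j - τ) =
          ((N * j : ℕ) : ℝ) * (κ * Real.log (j : ℝ) - (τ - (τ₀ - 2 * η))) := by
        simp only [σ]; push_cast; ring
      rw [this]; exact hjδ
    refine ⟨N * j, hball ?_⟩
    have hexp : ((z • T) ^ (N * j)) (u + ∑ t ∈ Finset.Icc 1 M,
        a t • W (θ t) (N * ((0 : ℕ) - (t : ℤ)))) =
        z ^ (N * j) • (T ^ (N * j)) u + ∑ t ∈ Finset.Icc 1 M,
          (z ^ (N * j) * a t) • W (θ t) (N * ((j : ℤ) - t)) := by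
      rw [smul_pow, _root_.smul_apply, map_add, map_sum, smul_add, Finset.smul_sum]
      congr 1
      refine Finset.sum_congr rfl fun t ht => ?_
      rw [map_smul, pow_apply_twoSidedOrbit (fun n => ((hW (θ t) (hθ t ht)).2 n).1), smul_smul]
      congr 2
      push_cast; ring
    have hzn : ‖z ^ (N * j)‖ = Real.exp (-(N * j * τ)) := by
      rw [norm_pow, hnz, ← Real.exp_nat_mul]; congr 1; push_cast; ring
    -- the start vector
    have hterm1 : ‖z ^ (N * j) • (T ^ (N * j)) u‖ < ε / 4 := by
      rw [norm_smul, hzn]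
      have h1 : N * j * (α - τ) ≤ -(N * η) := by
        have : (N : ℝ) ≤ N * j := le_mul_of_one_le_right hN0.le (by exact_mod_cast hj1)
        nlinarith
      calc _ ≤ Real.exp (-(N * j * τ)) * (|Cu| * Real.exp ((N * j : ℕ) * α)) := by
            gcongr
            refine (hCu _).trans ?_
            gcongr
            exact le_abs_self _
        _ = |Cu| * Real.exp (N * j * (α - τ)) := by
            rw [mul_left_comm, ← Real.exp_add]; congr 2; push_cast; ring
        _ ≤ |Cu| * Real.exp (-(N * η)) := by gcongr
        _ < ε / 4 := hNu
    -- the other blocks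
    have hterm2 : ‖∑ t ∈ (Finset.Icc 1 M).erase j,
        (z ^ (N * j) * a t) • W (θ t) (N * ((j : ℤ) - t))‖ < ε / 4 := by
      refine lt_of_le_of_lt ?_ (hNB.trans_le (min_le_left _ _))
      refine (norm_sum_le _ _).trans ?_
      calc _ ≤ ∑ t ∈ (Finset.Icc 1 M).erase j,
            Real.exp 1 * (C / (N : ℝ) ^ 2 * (1 / ((j : ℝ) - t) ^ 2)) := by
            refine Finset.sum_le_sum fun t ht => ?_
            rw [Finset.mem_erase] at ht
            rw [norm_smul, norm_mul, hzn, ha, ← Real.exp_add]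
            -- Replacing `τ` by `σ j` costs at most `exp δ ≤ exp 1`.
            calc _ ≤ Real.exp (1 + (N * t * σ t - N * j * σ j)) *
                  ‖W (θ t) (N * ((j : ℤ) - t))‖ := by
                  refine mul_le_mul_of_nonneg_right (Real.exp_le_exp.2 ?_) (norm_nonneg _)
                  have := (abs_le.1 hjσ).2
                  linarith
              _ ≤ _ := by
                  rw [Real.exp_add, mul_assoc]
                  exact mul_le_mul_of_nonneg_left (hcross t ht.2 j ht.1.symm) (Real.exp_pos _).le
        _ ≤ _ := by
            rw [← Finset.mul_sum, ← Finset.mul_sum]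
            gcongr
            exact sum_one_div_sub_sq_le _ j
    -- the main block
    have hterm3 : ‖(z ^ (N * j) * a j) • W (θ j) (N * ((j : ℤ) - j)) - v‖ < ε / 2 := by
      rw [sub_self, mul_zero]
      have hw := (hW (θ j) (hθ j hjmem)).1
      have hq : z ^ (N * j) * a j =
          (Real.exp (N * j * (σ j - τ)) : ℂ) * (ω ^ (N * t₁) * (ω ^ N) ^ i * c i) := by
        have e1 : (Real.exp (-τ) : ℂ) ^ (N * j) * (Real.exp (N * j * σ j) : ℂ) =
            (Real.exp (N * j * (σ j - τ)) : ℂ) := by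
          rw [← Complex.ofReal_pow, ← Complex.ofReal_mul, ← Real.exp_nat_mul, ← Real.exp_add]
          congr 2; push_cast; ring
        rw [← e1]
        conv_lhs => rw [hzω]
        simp only [a, hjmod]
        rw [mul_pow, hj, mul_add N, pow_add ω, pow_mul ω N i]
        ring
      have hq1 : ‖z ^ (N * j) * a j - 1‖ ≤ 5 * δ := by
        rw [hq]; exact norm_exp_mul_sub_one_le hδ1 hjσ hi.le
      have hWn : ‖W (θ j) 0‖ ≤ ‖v‖ + ε := by
        have := norm_le_norm_add_norm_sub v (W (θ j) 0)
        rw [norm_sub_rev] at this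
        linarith
      calc _ = ‖(z ^ (N * j) * a j - 1) • W (θ j) 0 + (W (θ j) 0 - v)‖ := by
            congr 1; rw [sub_smul, one_smul]; abel
        _ ≤ 5 * δ * (‖v‖ + ε) + ‖W (θ j) 0 - v‖ := by
            refine (norm_add_le _ _).trans ?_
            rw [norm_smul]
            gcongr
        _ < ε / 2 := by linarith
    rw [Metric.mem_ball, dist_eq_norm, hexp, ← Finset.add_sum_erase _ _ hjmem]
    set p := z ^ (N * j) • (T ^ (N * j)) u
    set q := (z ^ (N * j) * a j) • W (θ j) (N * ((j : ℤ) - j))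
    set s := ∑ t ∈ (Finset.Icc 1 M).erase j, (z ^ (N * j) * a t) • W (θ t) (N * ((j : ℤ) - t))
    calc ‖p + (q + s) - v‖ = ‖p + (q - v) + s‖ := by congr 1; abel
      _ ≤ ‖p‖ + ‖q - v‖ + ‖s‖ := norm_add₃_le
      _ < ε / 4 + ε / 2 + ε / 4 := by gcongr
      _ = ε := by ring

end Criterion

/-! ### Identity theorem, non-critical points and local logarithms -/

theorem convex_line_preimage_ball {E : Type*} [NormedAddCommGroup E] [NormedSpace ℂ E]
    (q d z : E) (r : ℝ) : Convex ℝ ((fun t : ℂ => q + t • d) ⁻¹' Metric.ball z r) := by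
  intro s hs t ht a b ha hb hab
  have := convex_ball z r hs ht ha hb hab
  have e : q + (a • s + b • t) • d = a • (q + s • d) + b • (q + t • d) := by
    simp only [smul_add, add_smul, ← Complex.coe_smul, smul_assoc]
    have : q = (a : ℂ) • q + (b : ℂ) • q := by
      rw [← add_smul]; norm_cast; rw [hab, one_smul]
    nth_rw 1 [this]
    abel
  rw [Set.mem_preimage, e]
  exact this

/-- The identity theorem for holomorphic functions of several variables. -/
theorem DifferentiableOn.eqOn_zero_of_eventuallyEq_zero {E : Type*} [NormedAddCommGroup E]
    [NormedSpace ℂ E] {F : E → ℂ} {U : Set E} (hF : DifferentiableOn ℂ F U) (hU : IsOpen U)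
    (hUc : IsPreconnected U) {p : E} (hp : p ∈ U) (h0 : ∀ᶠ z in 𝓝 p, F z = 0) :
    ∀ z ∈ U, F z = 0 := by
  have hsub : U ⊆ {z | ∀ᶠ w in 𝓝 z, F w = 0} := by
    refine hUc.subset_of_closure_inter_subset isOpen_setOfPred_eventually_nhds ⟨p, hp, h0⟩ ?_
    rintro z ⟨hz, hzU⟩
    obtain ⟨r, hr, hball⟩ := Metric.isOpen_iff.1 hU z hzU
    obtain ⟨q, hq, hqz⟩ := Metric.mem_closure_iff.1 hz r hr
    rw [dist_comm] at hqz
    refine Filter.mem_of_superset (Metric.ball_mem_nhds z hr) fun w hw => ?_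
    -- The complex line through `q` and `w` meets the ball in a convex set, so the one-variable
    -- identity theorem carries the zero from near `q` to `w`.
    set ℓ : ℂ → E := fun t => q + t • (w - q) with hℓ
    have hℓd : Differentiable ℂ ℓ := by fun_prop
    set O : Set ℂ := ℓ ⁻¹' Metric.ball z r with hO
    have hOo : IsOpen O := Metric.isOpen_ball.preimage hℓd.continuous
    have hOc : Convex ℝ O := convex_line_preimage_ball q (w - q) z r
    have hd : DifferentiableOn ℂ (F ∘ ℓ) O :=
      hF.comp hℓd.differentiableOn fun t ht => hball ht
    have h0O : (0 : ℂ) ∈ O := by simpa [hO, hℓ] using hqz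
    have h1O : (1 : ℂ) ∈ O := by simpa [hO, hℓ] using hw
    have hev : F ∘ ℓ =ᶠ[𝓝 0] 0 := by
      have : Tendsto ℓ (𝓝 0) (𝓝 q) := by
        have := hℓd.continuous.tendsto 0
        simpa [hℓ] using this
      exact this.eventually hq
    have := (hd.analyticOnNhd hOo).eqOn_zero_of_preconnected_of_eventuallyEq_zero
      hOc.isPreconnected h0O hev h1O
    simpa [hℓ] using this
  exact fun z hz => (hsub hz).self_of_nhds

/-- A non-constant holomorphic function that attains a modulus also attains it at a non-critical
point. -/
theorem exists_norm_eq_and_deriv_ne_zero {g : ℂ → ℂ} {O : Set ℂ} (hg : AnalyticOnNhd ℂ g O)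
    (hO : IsOpen O) (hOc : IsPreconnected O) {t₁ t₂ : ℂ} (h₁ : t₁ ∈ O) (h₂ : t₂ ∈ O)
    (hne : g t₂ ≠ g t₁) (h0 : g t₁ ≠ 0) :
    ∃ t ∈ O, ‖g t‖ = ‖g t₁‖ ∧ deriv g t ≠ 0 := by
  have hnc : ¬ ∀ᶠ t in 𝓝 t₁, g t = g t₁ := by
    intro h
    have := hg.eqOn_of_preconnected_of_eventuallyEq (analyticOnNhd_const (v := g t₁)) hOc h₁ h
    exact hne (this h₂)
  have hopen := (hg t₁ h₁).eventually_constant_or_nhds_le_map_nhds.resolve_left hnc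
  have hder : ∀ᶠ t in 𝓝[≠] t₁, deriv g t ≠ 0 := by
    refine (hg t₁ h₁).deriv.eventually_eq_zero_or_eventually_ne_zero.resolve_left fun h => hnc ?_
    have hd : ∀ᶠ t in 𝓝 t₁, DifferentiableAt ℂ g t :=
      (hg t₁ h₁).eventually_analyticAt.mono fun t ht => ht.differentiableAt
    obtain ⟨r, hr, hball⟩ := Metric.eventually_nhds_iff_ball.1 (h.and hd)
    refine Filter.mem_of_superset (Metric.ball_mem_nhds t₁ hr) fun t ht => ?_
    exact Metric.isOpen_ball.is_const_of_deriv_eq_zero (convex_ball t₁ r).isPreconnected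
      (fun s hs => (hball s hs).2.differentiableWithinAt) (fun s hs => (hball s hs).1) ht
      (Metric.mem_ball_self hr)
  rw [eventually_nhdsWithin_iff] at hder
  -- By the open mapping theorem the image stays a neighbourhood of `g t₁` after nearby critical
  -- points other than `t₁` are discarded. It therefore contains slightly rotated values `exp (i s)
  -- * g t₁`, and their preimages differ from `t₁`.
  have hS : g '' {t | t ∈ O ∧ (t ≠ t₁ → deriv g t ≠ 0)} ∈ 𝓝 (g t₁) :=
    hopen (image_mem_map (Filter.inter_mem (hO.mem_nhds h₁) hder))
  have hrot : Tendsto (fun s : ℝ => Complex.exp (s * Complex.I) * g t₁) (𝓝[≠] 0) (𝓝 (g t₁)) := by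
    have : Continuous fun s : ℝ => Complex.exp (s * Complex.I) * g t₁ := by fun_prop
    have := this.tendsto 0
    simp only [Complex.ofReal_zero, zero_mul, Complex.exp_zero, one_mul] at this
    exact this.mono_left nhdsWithin_le_nhds
  have hsmall : ∀ᶠ s : ℝ in 𝓝[≠] 0, s ≠ 0 ∧ |s| < 1 := by
    refine (eventually_mem_nhdsWithin).and (nhdsWithin_le_nhds ?_)
    have : Tendsto (fun s : ℝ => |s|) (𝓝 0) (𝓝 |0|) := continuous_abs.tendsto 0
    rw [abs_zero] at this
    exact this.eventually (gt_mem_nhds one_pos)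
  obtain ⟨s, ⟨t, ⟨htO, htd⟩, hts⟩, hs0, hs1⟩ := ((hrot.eventually hS).and hsmall).exists
  refine ⟨t, htO, by rw [hts, norm_mul, Complex.norm_exp_ofReal_mul_I, one_mul], htd ?_⟩
  rintro rfl
  have h1 : Complex.exp (s * Complex.I) = 1 := by
    have : (Complex.exp (s * Complex.I) - 1) * g t = 0 := by rw [sub_mul, ← hts]; ring
    exact sub_eq_zero.1 ((mul_eq_zero.1 this).resolve_right h0)
  have h2 := congrArg Complex.im h1
  rw [Complex.exp_ofReal_mul_I_im, Complex.one_im] at h2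
  have hpi := Real.pi_gt_three
  rw [abs_lt] at hs1
  exact hs0 ((Real.sin_eq_zero_iff_of_lt_of_lt (by linarith) (by linarith)).1 h2)

/-- Near a non-critical point where `g ≠ 0` there is a holomorphic right inverse of `log g`. -/
theorem exists_local_section_exp {g : ℂ → ℂ} {O : Set ℂ} (hO : IsOpen O) {t₀ : ℂ} (ht₀ : t₀ ∈ O)
    (hg : AnalyticAt ℂ g t₀) (h0 : g t₀ ≠ 0) (hd : deriv g t₀ ≠ 0) :
    ∃ (ζ₀ : ℂ) (r : ℝ) (ψ : ℂ → ℂ), Complex.exp ζ₀ = g t₀ ∧ 0 < r ∧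
      DifferentiableOn ℂ ψ (Metric.ball ζ₀ r) ∧
      (∀ ζ ∈ Metric.ball ζ₀ r, ψ ζ ∈ O ∧ g (ψ ζ) = Complex.exp ζ) ∧
      ∀ᶠ t in 𝓝 t₀, ∃ ζ ∈ Metric.ball ζ₀ r, ψ ζ = t := by
  set ζ₀ := Complex.log (g t₀) with hζ₀
  have hexp : Complex.exp ζ₀ = g t₀ := Complex.exp_log h0
  -- Dividing by `g t₀` keeps the argument of the logarithm near `1`, away from the branch cut.
  set L : ℂ → ℂ := fun t => Complex.log (g t / g t₀) + ζ₀ with hL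
  have hq : AnalyticAt ℂ (fun t => g t / g t₀) t₀ := hg.div analyticAt_const h0
  have hLan : AnalyticAt ℂ L t₀ := by
    refine AnalyticAt.add (hq.clog ?_) analyticAt_const
    simp [div_self h0]
  have hL0 : L t₀ = ζ₀ := by simp [hL, div_self h0]
  have hLd : deriv L t₀ ≠ 0 := by
    have h1 : HasDerivAt L (deriv g t₀ / g t₀ / (g t₀ / g t₀)) t₀ :=
      ((hg.differentiableAt.hasDerivAt.div_const (g t₀)).clog (by simp [div_self h0])).add_const _
    rw [h1.deriv, div_self h0, div_one]
    exact div_ne_zero hd h0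
  have hLexp : ∀ᶠ t in 𝓝 t₀, Complex.exp (L t) = g t := by
    filter_upwards [hg.continuousAt.eventually_ne h0] with t ht
    rw [hL, Complex.exp_add, Complex.exp_log (div_ne_zero ht h0), hexp, div_mul_cancel₀ _ h0]
  set ψ := hLan.hasStrictDerivAt.localInverse L (deriv L t₀) t₀ hLd with hψ
  have hψan : AnalyticAt ℂ ψ ζ₀ := by
    have := hLan.analyticAt_localInverse hLd
    rwa [hL0] at this
  have hψl : ∀ᶠ t in 𝓝 t₀, ψ (L t) = t := hLan.hasStrictDerivAt.eventually_left_inverse hLd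
  have hψr : ∀ᶠ ζ in 𝓝 ζ₀, L (ψ ζ) = ζ := by
    have := hLan.hasStrictDerivAt.eventually_right_inverse hLd
    rwa [hL0] at this
  have hψ0 : ψ ζ₀ = t₀ := by have := hψl.self_of_nhds; rwa [hL0] at this
  have hψt : Tendsto ψ (𝓝 ζ₀) (𝓝 t₀) := by
    have := hψan.continuousAt.tendsto; rwa [hψ0] at this
  obtain ⟨r, hr, hball⟩ := Metric.eventually_nhds_iff_ball.1
    ((hψan.eventually_analyticAt.and hψr).and
      ((hψt.eventually hLexp).and (hψt.eventually (hO.mem_nhds ht₀))))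
  refine ⟨ζ₀, r, ψ, hexp, hr, fun ζ hζ =>
    (hball ζ hζ).1.1.differentiableAt.differentiableWithinAt, fun ζ hζ => ⟨(hball ζ hζ).2.2, ?_⟩, ?_⟩
  · rw [← (hball ζ hζ).2.1, (hball ζ hζ).1.2]
  · have hLt : Tendsto L (𝓝 t₀) (𝓝 ζ₀) := by
      have := hLan.continuousAt.tendsto; rwa [hL0] at this
    filter_upwards [hψl, hLt.eventually (Metric.ball_mem_nhds ζ₀ hr)] with t ht hb
    exact ⟨L t, hb, ht⟩

/-! ### Two-sided orbits from holomorphic eigenfunctionals -/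

/-- The quadratic decay of the Fourier integrals of a `C²` function that vanishes at both ends. -/
theorem norm_integral_exp_mul_mul_sq_le {G G' G'' : ℝ → ℂ} {a b A : ℝ} (hab : a ≤ b)
    (hb : b - a ≤ 1)
    (hG : ∀ s ∈ Set.Icc a b, HasDerivAt G (G' s) s)
    (hG' : ∀ s ∈ Set.Icc a b, HasDerivAt G' (G'' s) s) (hc : ContinuousOn G'' (Set.Icc a b))
    (ha0 : G a = 0) (hb0 : G b = 0) (h1 : ∀ s ∈ Set.Icc a b, ‖G' s‖ ≤ A)
    (h2 : ∀ s ∈ Set.Icc a b, ‖G'' s‖ ≤ A) (n : ℤ) :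
    ‖∫ s in a..b, Complex.exp (n * (s * Complex.I)) * G s‖ * (n : ℝ) ^ 2 ≤ 3 * A := by
  have hA : 0 ≤ A := (norm_nonneg _).trans (h1 a (Set.left_mem_Icc.2 hab))
  rcases eq_or_ne n 0 with rfl | hn
  · simpa using hA
  have hn' : (n : ℂ) ≠ 0 := by exact_mod_cast hn
  set c : ℂ := n * Complex.I with hcdef
  have hc0 : c ≠ 0 := mul_ne_zero hn' Complex.I_ne_zero
  have hcn : ‖c‖ = |(n : ℝ)| := by simp [hcdef]
  set e : ℝ → ℂ := fun s => Complex.exp (n * (s * Complex.I)) with he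
  have hen : ∀ s, ‖e s‖ = 1 := by
    intro s
    have : (n : ℂ) * (s * Complex.I) = ((n * s : ℝ) : ℂ) * Complex.I := by push_cast; ring
    simp only [he, this, Complex.norm_exp_ofReal_mul_I]
  have hed : ∀ s, HasDerivAt (fun s => e s / c) (e s) s := by
    intro s
    have h0 : HasDerivAt (fun s : ℝ => (n : ℂ) * (s * Complex.I)) c s := by
      have := ((hasDerivAt_id s).ofReal_comp.mul_const Complex.I).const_mul (n : ℂ)
      simpa [hcdef] using this
    have := h0.cexp.div_const c
    rwa [mul_div_cancel_right₀ _ hc0] at this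
  have hec : Continuous e := by simp only [he]; fun_prop
  have huIcc : Set.uIcc a b = Set.Icc a b := Set.uIcc_of_le hab
  have hG'c : ContinuousOn G' (Set.Icc a b) :=
    fun s hs => (hG' s hs).continuousAt.continuousWithinAt
  have i1 : ∫ s in a..b, G s * e s = - ((∫ s in a..b, G' s * e s) / c) := by
    rw [intervalIntegral.integral_mul_deriv_eq_deriv_mul (u := G) (v := fun s => e s / c)
      (u' := G') (v' := e) (by rwa [huIcc]) (fun s _ => hed s)
      (by rw [← huIcc] at hG'c; exact hG'c.intervalIntegrable) (hec.intervalIntegrable _ _),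
      ha0, hb0, ← intervalIntegral.integral_div]
    simp [mul_div_assoc]
  have i2 : ∫ s in a..b, G' s * e s =
      (G' b * e b - G' a * e a - ∫ s in a..b, G'' s * e s) / c := by
    rw [intervalIntegral.integral_mul_deriv_eq_deriv_mul (u := G') (v := fun s => e s / c)
      (u' := G'') (v' := e) (by rwa [huIcc]) (fun s _ => hed s)
      (by rw [← huIcc] at hc; exact hc.intervalIntegrable) (hec.intervalIntegrable _ _),
      sub_div, sub_div, ← intervalIntegral.integral_div]
    simp [mul_div_assoc]
  -- Two integrations by parts leave the boundary terms of `G'`, which need not vanish: two of size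
  -- `A`, plus the integral.
  have hbound : ‖G' b * e b - G' a * e a - ∫ s in a..b, G'' s * e s‖ ≤ 3 * A := by
    have j1 : ‖G' b * e b‖ ≤ A := by
      rw [norm_mul, hen, mul_one]; exact h1 b (Set.right_mem_Icc.2 hab)
    have j2 : ‖G' a * e a‖ ≤ A := by
      rw [norm_mul, hen, mul_one]; exact h1 a (Set.left_mem_Icc.2 hab)
    have j3 : ‖∫ s in a..b, G'' s * e s‖ ≤ A * |b - a| := by
      refine intervalIntegral.norm_integral_le_of_norm_le_const fun s hs => ?_
      rw [Set.uIoc_of_le hab] at hs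
      rw [norm_mul, hen, mul_one]
      exact h2 s ⟨hs.1.le, hs.2⟩
    rw [abs_of_nonneg (sub_nonneg.2 hab)] at j3
    have j4 : A * (b - a) ≤ A := mul_le_of_le_one_right hA hb
    linarith [norm_sub_le (G' b * e b - G' a * e a) (∫ s in a..b, G'' s * e s),
      norm_sub_le (G' b * e b) (G' a * e a)]
  have i3 : ∫ s in a..b, e s * G s = -((G' b * e b - G' a * e a - ∫ s in a..b, G'' s * e s) / c ^ 2) := by
    rw [show (fun s => e s * G s) = fun s => G s * e s from funext fun s => mul_comm _ _, i1, i2,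
      div_div, sq]
  have hn2 : (0 : ℝ) < (n : ℝ) ^ 2 := by positivity
  rw [i3, norm_neg, norm_div, norm_pow, hcn, sq_abs, div_mul_cancel₀ _ hn2.ne']
  exact hbound

section EigenFunctionals

open scoped InnerProductSpace

variable {H : Type*} [NormedAddCommGroup H] [InnerProductSpace ℂ H]

theorem norm_inner_self_eq_norm_sq (w : H) : ‖⟪w, w⟫_ℂ‖ = ‖w‖ ^ 2 := by
  rw [inner_self_eq_norm_sq_to_K]
  simp

theorem norm_le_of_forall_norm_inner_le {w : H} {C : ℝ} (hC : 0 ≤ C) (h : ∀ f, ‖⟪w, f⟫_ℂ‖ ≤ C * ‖f‖) :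
    ‖w‖ ≤ C := by
  have h1 := h w
  rw [norm_inner_self_eq_norm_sq, sq] at h1
  rcases (norm_nonneg w).eq_or_lt with h0 | h0
  · rwa [← h0]
  · exact le_of_mul_le_mul_right h1 h0

variable [CompleteSpace H]

/-- Weakly holomorphic families of functionals satisfy locally uniform Cauchy estimates. -/
theorem exists_bound_of_weakly_differentiableOn {K : ℂ → H →L[ℂ] ℂ} {ζ₀ : ℂ} {r : ℝ} (hr : 0 < r)
    (hd : ∀ f, DifferentiableOn ℂ (fun ζ => K ζ f) (Metric.ball ζ₀ r)) :
    ∃ A : ℝ, 0 ≤ A ∧ ∀ f, ∀ ζ ∈ Metric.closedBall ζ₀ (r / 4), ‖K ζ f‖ ≤ A * ‖f‖ ∧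
      ‖deriv (fun ζ => K ζ f) ζ‖ ≤ A * ‖f‖ ∧ ‖deriv (deriv fun ζ => K ζ f) ζ‖ ≤ A * ‖f‖ := by
  have hsub : Metric.closedBall ζ₀ (r / 2) ⊆ Metric.ball ζ₀ r :=
    Metric.closedBall_subset_ball (by linarith)
  -- Pointwise bounds on a compact disc become a uniform norm bound; Cauchy estimates on discs of
  -- radius `r / 4` then control both derivatives.
  obtain ⟨B, hB⟩ := banach_steinhaus (g := fun ζ : Metric.closedBall ζ₀ (r / 2) => K ζ) fun f => by
    obtain ⟨C, hC⟩ := (isCompact_closedBall ζ₀ (r / 2)).exists_bound_of_continuousOn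
      ((hd f).continuousOn.mono hsub)
    exact ⟨C, fun ζ => hC ζ ζ.2⟩
  have hB0 : 0 ≤ B := (norm_nonneg _).trans (hB ⟨ζ₀, Metric.mem_closedBall_self (by positivity)⟩)
  set A := max B (max (B / (r / 4)) (2 * B / (r / 4) ^ 2)) with hA
  have hA1 : B ≤ A := le_max_left _ _
  have hA2 : B / (r / 4) ≤ A := (le_max_left _ _).trans (le_max_right _ _)
  have hA3 : 2 * B / (r / 4) ^ 2 ≤ A := (le_max_right _ _).trans (le_max_right _ _)
  refine ⟨A, hB0.trans hA1, fun f ζ hζ => ?_⟩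
  have hle : ∀ w ∈ Metric.closedBall ζ₀ (r / 2), ‖K w f‖ ≤ B * ‖f‖ := fun w hw =>
    (K w).le_of_opNorm_le (hB ⟨w, hw⟩) f
  have hcb : Metric.closedBall ζ (r / 4) ⊆ Metric.closedBall ζ₀ (r / 2) := by
    refine Metric.closedBall_subset_closedBall' ?_
    have := Metric.mem_closedBall.1 hζ
    linarith
  have hdc : DiffContOnCl ℂ (fun ζ => K ζ f) (Metric.ball ζ (r / 4)) := by
    refine DifferentiableOn.diffContOnCl ?_
    rw [closure_ball _ (by positivity)]
    exact (hd f).mono (hcb.trans hsub)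
  have hsph : ∀ w ∈ Metric.sphere ζ (r / 4), ‖K w f‖ ≤ B * ‖f‖ := fun w hw =>
    hle w (hcb (Metric.sphere_subset_closedBall hw))
  have h1 := Complex.norm_deriv_le_of_forall_mem_sphere_norm_le (by positivity) hdc hsph
  have h2 := Complex.norm_iteratedDeriv_le_of_forall_mem_sphere_norm_le 2 (by positivity) hdc hsph
  rw [iteratedDeriv_succ, iteratedDeriv_one] at h2
  refine ⟨(hle ζ (Metric.closedBall_subset_closedBall (by linarith) hζ)).trans (by gcongr),
    h1.trans ?_, h2.trans ?_⟩
  · calc B * ‖f‖ / (r / 4) = B / (r / 4) * ‖f‖ := by ring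
      _ ≤ A * ‖f‖ := by gcongr
  · calc ((2 : ℕ).factorial : ℝ) * (B * ‖f‖) / (r / 4) ^ 2 = 2 * B / (r / 4) ^ 2 * ‖f‖ := by
          simp [Nat.factorial]; ring
      _ ≤ A * ‖f‖ := by gcongr

variable {K : ℂ → H →L[ℂ] ℂ} {ζ₀ : ℂ} {r : ℝ}

theorem add_mul_I_mem_closedBall {τ s ρ : ℝ} (hτ : |τ - ζ₀.re| ≤ ρ) (hs : |s - ζ₀.im| ≤ ρ) :
    (τ + s * Complex.I : ℂ) ∈ Metric.closedBall ζ₀ (2 * ρ) := by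
  have e : (τ + s * Complex.I : ℂ) - ζ₀ =
      ((τ - ζ₀.re : ℝ) : ℂ) + ((s - ζ₀.im : ℝ) : ℂ) * Complex.I := by
    apply Complex.ext <;> simp
  rw [Metric.mem_closedBall, dist_eq_norm, e]
  refine (norm_add_le _ _).trans ?_
  rw [norm_mul, Complex.norm_I, mul_one, Complex.norm_real, Complex.norm_real, Real.norm_eq_abs,
    Real.norm_eq_abs]
  linarith

/-- Holomorphic families of eigenfunctionals of `M` integrate to two-sided orbits of the
adjoint. -/
theorem exists_twoSidedOrbitsNear_adjoint (M : H →L[ℂ] H) (hr : 0 < r)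
    (hd : ∀ f, DifferentiableOn ℂ (fun ζ => K ζ f) (Metric.ball ζ₀ r))
    (hK : ∀ ζ ∈ Metric.ball ζ₀ r, ∀ f, K ζ (M f) = Complex.exp ζ * K ζ f)
    {a b : ℝ} (hab : a ≤ b) (hb1 : b - a ≤ 1) (ha : ζ₀.im - r / 8 ≤ a) (hb : b ≤ ζ₀.im + r / 8) :
    ∃ v : H, TwoSidedOrbitsNear (ContinuousLinearMap.adjoint M) ζ₀.re v ∧
      ∀ f, ⟪v, f⟫_ℂ =
        ∫ s in a..b, (((s - a) * (b - s) : ℝ) : ℂ) * K (ζ₀.re + s * Complex.I) f := by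
  obtain ⟨A, hA0, hA⟩ := exists_bound_of_weakly_differentiableOn hr hd
  have hsub : Metric.closedBall ζ₀ (r / 4) ⊆ Metric.ball ζ₀ r :=
    Metric.closedBall_subset_ball (by linarith)
  have hmem : ∀ τ : ℝ, |τ - ζ₀.re| ≤ r / 8 → ∀ s ∈ Set.Icc a b,
      (τ + s * Complex.I : ℂ) ∈ Metric.closedBall ζ₀ (r / 4) := by
    intro τ hτ s hs
    have := add_mul_I_mem_closedBall (ζ₀ := ζ₀) hτ
      (s := s) (abs_le.2 ⟨by linarith [hs.1], by linarith [hs.2]⟩)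
    rwa [show 2 * (r / 8) = r / 4 by ring] at this
  have hζc : ∀ τ : ℝ, Continuous fun s : ℝ => (τ + s * Complex.I : ℂ) := fun τ => by fun_prop
  have hcont : ∀ τ : ℝ, |τ - ζ₀.re| ≤ r / 8 → ∀ f,
      ContinuousOn (fun s : ℝ => K (τ + s * Complex.I) f) (Set.Icc a b) := fun τ hτ f =>
    (hd f).continuousOn.comp (hζc τ).continuousOn fun s hs => hsub (hmem τ hτ s hs)
  have hIcc : Set.uIcc a b = Set.Icc a b := Set.uIcc_of_le hab
  -- the integrand defining the orbit
  let Φ : ℝ → ℤ → H → ℝ → ℂ := fun τ n f s =>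
    (((s - a) * (b - s) : ℝ) : ℂ) * (Complex.exp (n * (τ + s * Complex.I)) *
      K (τ + s * Complex.I) f)
  have hΦc : ∀ τ : ℝ, |τ - ζ₀.re| ≤ r / 8 → ∀ n f, ContinuousOn (Φ τ n f) (Set.uIcc a b) := by
    intro τ hτ n f
    rw [hIcc]
    exact (by fun_prop : Continuous fun s : ℝ => (((s - a) * (b - s) : ℝ) : ℂ)).continuousOn.mul
      ((by fun_prop : Continuous fun s : ℝ =>
        Complex.exp (n * (τ + s * Complex.I))).continuousOn.mul (hcont τ hτ f))
  have hwt : ∀ s ∈ Set.Icc a b, ‖(((s - a) * (b - s) : ℝ) : ℂ)‖ ≤ 1 := by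
    intro s hs
    rw [Complex.norm_real, Real.norm_eq_abs, abs_of_nonneg
      (mul_nonneg (by linarith [hs.1]) (by linarith [hs.2]))]
    nlinarith [hs.1, hs.2]
  have hexn : ∀ (n : ℤ) (τ s : ℝ), ‖Complex.exp (n * (τ + s * Complex.I))‖ = Real.exp (n * τ) := by
    intro n τ s
    rw [Complex.norm_exp]
    congr 1
    simp
  have hW : ∀ τ : ℝ, |τ - ζ₀.re| ≤ r / 8 → ∀ n : ℤ, ∃ w : H, ∀ f,
      ⟪w, f⟫_ℂ = ∫ s in a..b, Φ τ n f s := by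
    intro τ hτ n
    have hint : ∀ f, IntervalIntegrable (Φ τ n f) MeasureTheory.volume a b := fun f =>
      (hΦc τ hτ n f).intervalIntegrable
    let ℓ : H →ₗ[ℂ] ℂ :=
      { toFun := fun f => ∫ s in a..b, Φ τ n f s
        map_add' := fun f g => by
          rw [← intervalIntegral.integral_add (hint f) (hint g)]
          refine intervalIntegral.integral_congr fun s _ => ?_
          simp only [Φ, map_add]; ring
        map_smul' := fun c f => by
          rw [RingHom.id_apply, ← intervalIntegral.integral_smul]
          refine intervalIntegral.integral_congr fun s _ => ?_
          simp only [Φ, map_smul, smul_eq_mul]; ring }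
    have hℓ : ∀ f, ‖ℓ f‖ ≤ Real.exp (n * τ) * A * ‖f‖ := by
      intro f
      have h1 : ‖∫ s in a..b, Φ τ n f s‖ ≤ Real.exp (n * τ) * A * ‖f‖ * |b - a| := by
        refine intervalIntegral.norm_integral_le_of_norm_le_const fun s hs => ?_
        rw [Set.uIoc_of_le hab] at hs
        have hs' : s ∈ Set.Icc a b := ⟨hs.1.le, hs.2⟩
        simp only [Φ]
        rw [norm_mul, norm_mul, hexn]
        have h2 := (hA f _ (hmem τ hτ s hs')).1
        calc _ ≤ 1 * (Real.exp (n * τ) * (A * ‖f‖)) :=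
              mul_le_mul (hwt s hs') (by gcongr) (by positivity) zero_le_one
          _ = _ := by ring
      rw [abs_of_nonneg (sub_nonneg.2 hab)] at h1
      exact h1.trans (mul_le_of_le_one_right (by positivity) hb1)
    refine ⟨(InnerProductSpace.toDual ℂ H).symm (ℓ.mkContinuous _ hℓ), fun f => ?_⟩
    rw [InnerProductSpace.toDual_symm_apply]
    rfl
  -- `W τ n` is the Riesz vector of the integral of `e^{nζ} K_ζ`, weighted by `(s - a) * (b - s)`,
  -- over `ζ = τ + i s`. The eigenvalue `e^ζ` turns the adjoint into the shift `n ↦ n + 1`.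
  choose! W hW using hW
  have hr8 : |ζ₀.re - ζ₀.re| ≤ r / 8 := by rw [sub_self, abs_zero]; positivity
  refine ⟨W ζ₀.re 0, ?_, fun f => ?_⟩
  swap
  · rw [hW _ hr8]
    refine intervalIntegral.integral_congr fun s _ => ?_
    simp [Φ]
  intro ε hε
  refine ⟨min (r / 8) (ε / (A + 1)), lt_min (by positivity) (by positivity), 3 * (5 * A), W,
    fun τ hτ => ?_⟩
  have hτ8 : |τ - ζ₀.re| ≤ r / 8 := hτ.le.trans (min_le_left _ _)
  have hτε : |τ - ζ₀.re| * (A + 1) < ε := by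
    have := hτ.trans_le (min_le_right _ _)
    rwa [lt_div_iff₀ (by positivity)] at this
  have hball : ∀ ζ ∈ Metric.closedBall ζ₀ (r / 4), Metric.ball ζ₀ r ∈ 𝓝 ζ := fun ζ hζ =>
    Metric.isOpen_ball.mem_nhds (hsub hζ)
  have hder : ∀ f, ∀ ζ ∈ Metric.closedBall ζ₀ (r / 4),
      HasDerivAt (fun ζ => K ζ f) (deriv (fun ζ => K ζ f) ζ) ζ := fun f ζ hζ =>
    ((hd f).differentiableAt (hball ζ hζ)).hasDerivAt
  have hder2 : ∀ f, ∀ ζ ∈ Metric.closedBall ζ₀ (r / 4),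
      HasDerivAt (deriv fun ζ => K ζ f) (deriv (deriv fun ζ => K ζ f) ζ) ζ := fun f ζ hζ =>
    (((hd f).deriv Metric.isOpen_ball).differentiableAt (hball ζ hζ)).hasDerivAt
  refine ⟨?_, fun n => ⟨?_, ?_⟩⟩
  · have key : ∀ f, ‖⟪W τ 0 - W ζ₀.re 0, f⟫_ℂ‖ ≤ A * |τ - ζ₀.re| * ‖f‖ := by
      intro f
      rw [inner_sub_left, hW τ hτ8, hW _ hr8, ← intervalIntegral.integral_sub
        (hΦc τ hτ8 0 f).intervalIntegrable (hΦc _ hr8 0 f).intervalIntegrable]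
      have h1 : ‖∫ s in a..b, (Φ τ 0 f s - Φ ζ₀.re 0 f s)‖ ≤
          A * |τ - ζ₀.re| * ‖f‖ * |b - a| := by
        refine intervalIntegral.norm_integral_le_of_norm_le_const fun s hs => ?_
        rw [Set.uIoc_of_le hab] at hs
        have hs' : s ∈ Set.Icc a b := ⟨hs.1.le, hs.2⟩
        have h2 := (convex_closedBall ζ₀ (r / 4)).norm_image_sub_le_of_norm_deriv_le
          (f := fun ζ => K ζ f) (fun ζ hζ => (hder f ζ hζ).differentiableAt)
          (fun ζ hζ => (hA f ζ hζ).2.1) (hmem _ hr8 s hs') (hmem τ hτ8 s hs')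
        have e : (τ + s * Complex.I : ℂ) - (ζ₀.re + s * Complex.I) = ((τ - ζ₀.re : ℝ) : ℂ) := by
          push_cast; ring
        rw [e, Complex.norm_real, Real.norm_eq_abs] at h2
        have e2 : Φ τ 0 f s - Φ ζ₀.re 0 f s = (((s - a) * (b - s) : ℝ) : ℂ) *
            (K (τ + s * Complex.I) f - K (ζ₀.re + s * Complex.I) f) := by
          simp [Φ]; ring
        rw [e2, norm_mul]
        calc _ ≤ 1 * (A * ‖f‖ * |τ - ζ₀.re|) :=
              mul_le_mul (hwt s hs') h2 (norm_nonneg _) zero_le_one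
          _ = _ := by ring
      rw [abs_of_nonneg (sub_nonneg.2 hab)] at h1
      exact h1.trans (mul_le_of_le_one_right (by positivity) hb1)
    have := norm_le_of_forall_norm_inner_le (by positivity) key
    nlinarith [abs_nonneg (τ - ζ₀.re)]
  · refine ext_inner_right ℂ fun f => ?_
    rw [ContinuousLinearMap.adjoint_inner_left, hW τ hτ8, hW τ hτ8]
    refine intervalIntegral.integral_congr fun s hs => ?_
    rw [hIcc] at hs
    simp only [Φ]
    rw [hK _ (hsub (hmem τ hτ8 s hs))]
    have e : Complex.exp (((n + 1 : ℤ) : ℂ) * (τ + s * Complex.I)) =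
        Complex.exp (n * (τ + s * Complex.I)) * Complex.exp (τ + s * Complex.I) := by
      rw [← Complex.exp_add]; congr 1; push_cast; ring
    rw [e]
    ring
  · have key : ∀ f, ‖⟪W τ n, f⟫_ℂ‖ * (n : ℝ) ^ 2 ≤ 3 * (5 * A) * Real.exp (n * τ) * ‖f‖ := by
      intro f
      set h : ℂ → ℂ := fun ζ => K ζ f with hh
      set z : ℝ → ℂ := fun s => τ + s * Complex.I with hz
      have hzd : ∀ s, HasDerivAt z Complex.I s := fun s => by
        have := ((hasDerivAt_id s).ofReal_comp.mul_const Complex.I).const_add (τ : ℂ)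
        simpa [hz] using this
      have hp : ∀ s : ℝ, HasDerivAt (fun s : ℝ => (((s - a) * (b - s) : ℝ) : ℂ))
          ((b + a - 2 * s : ℝ) : ℂ) s := fun s => by
        have := (((hasDerivAt_id s).sub_const a).mul ((hasDerivAt_id s).const_sub b)).ofReal_comp
        exact this.congr_deriv (by simp only [id]; push_cast; ring)
      have hp' : ∀ s : ℝ, HasDerivAt (fun s : ℝ => ((b + a - 2 * s : ℝ) : ℂ)) (-2) s := fun s => by
        have := (((hasDerivAt_id s).const_mul 2).const_sub (b + a)).ofReal_comp
        exact this.congr_deriv (by push_cast; ring)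
      have hc1 : ∀ s ∈ Set.Icc a b,
          HasDerivAt (fun s => h (z s)) (deriv h (z s) * Complex.I) s := fun s hs => by
        have e : HasDerivAt h (deriv h (z s)) (z s) := hder f _ (hmem τ hτ8 s hs)
        exact e.comp s (hzd s)
      have hc2 : ∀ s ∈ Set.Icc a b, HasDerivAt (fun s => deriv h (z s))
          (deriv (deriv h) (z s) * Complex.I) s := fun s hs => by
        have e : HasDerivAt (deriv h) (deriv (deriv h) (z s)) (z s) :=
          hder2 f _ (hmem τ hτ8 s hs)
        exact e.comp s (hzd s)
      have hpb : ∀ s ∈ Set.Icc a b, ‖((b + a - 2 * s : ℝ) : ℂ)‖ ≤ 1 := fun s hs => by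
        rw [Complex.norm_real, Real.norm_eq_abs, abs_le]
        constructor <;> linarith [hs.1, hs.2]
      -- The factor `5` counts the second derivative of weight times `h`: `2` from the weight's
      -- second derivative, `1 + 1` from the mixed terms and `1` from that of `h`.
      have hI := norm_integral_exp_mul_mul_sq_le (a := a) (b := b) (A := 5 * (A * ‖f‖))
        (G := fun s => (((s - a) * (b - s) : ℝ) : ℂ) * h (z s))
        (G' := fun s => ((b + a - 2 * s : ℝ) : ℂ) * h (z s) +
          (((s - a) * (b - s) : ℝ) : ℂ) * (deriv h (z s) * Complex.I))
        (G'' := fun s => (-2 * h (z s) + ((b + a - 2 * s : ℝ) : ℂ) * (deriv h (z s) * Complex.I)) +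
          (((b + a - 2 * s : ℝ) : ℂ) * (deriv h (z s) * Complex.I) +
            (((s - a) * (b - s) : ℝ) : ℂ) * (deriv (deriv h) (z s) * Complex.I * Complex.I)))
        hab hb1 ?_ ?_ ?_ (by simp) (by simp) ?_ ?_ n
      · rw [hW τ hτ8]
        have e : ∫ s in a..b, Φ τ n f s = Complex.exp (n * τ) *
            ∫ s in a..b, Complex.exp (n * (s * Complex.I)) *
              ((((s - a) * (b - s) : ℝ) : ℂ) * h (z s)) := by
          rw [← intervalIntegral.integral_const_mul]
          refine intervalIntegral.integral_congr fun s _ => ?_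
          simp only [Φ, hh, hz]
          rw [mul_add, Complex.exp_add]
          ring
        have e' : ‖Complex.exp (n * τ)‖ = Real.exp (n * τ) := by
          rw [Complex.norm_exp]; congr 1; simp
        rw [e, norm_mul, e', mul_assoc]
        calc _ ≤ Real.exp (n * τ) * (3 * (5 * (A * ‖f‖))) :=
              mul_le_mul_of_nonneg_left hI (Real.exp_pos _).le
          _ = _ := by ring
      · intro s hs
        exact (hp s).mul (hc1 s hs)
      · intro s hs
        exact ((hp' s).mul (hc1 s hs)).add ((hp s).mul ((hc2 s hs).mul_const Complex.I))
      · have hmaps : Set.MapsTo z (Set.Icc a b) (Metric.ball ζ₀ r) := fun s hs =>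
          hsub (hmem τ hτ8 s hs)
        have c0 : ContinuousOn (fun s => h (z s)) (Set.Icc a b) :=
          (hd f).continuousOn.comp (hζc τ).continuousOn hmaps
        have c1 : ContinuousOn (fun s => deriv h (z s)) (Set.Icc a b) :=
          ((hd f).deriv Metric.isOpen_ball).continuousOn.comp (hζc τ).continuousOn hmaps
        have c2 : ContinuousOn (fun s => deriv (deriv h) (z s)) (Set.Icc a b) :=
          (((hd f).deriv Metric.isOpen_ball).deriv Metric.isOpen_ball).continuousOn.comp
            (hζc τ).continuousOn hmaps
        have p0 : ContinuousOn (fun s : ℝ => (((s - a) * (b - s) : ℝ) : ℂ)) (Set.Icc a b) :=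
          (by fun_prop : Continuous _).continuousOn
        have p1 : ContinuousOn (fun s : ℝ => ((b + a - 2 * s : ℝ) : ℂ)) (Set.Icc a b) :=
          (by fun_prop : Continuous _).continuousOn
        exact ((continuousOn_const.mul c0).add (p1.mul (c1.mul continuousOn_const))).add
          ((p1.mul (c1.mul continuousOn_const)).add
            (p0.mul ((c2.mul continuousOn_const).mul continuousOn_const)))
      · intro s hs
        obtain ⟨b0, b1, -⟩ := hA f _ (hmem τ hτ8 s hs)
        refine (norm_add_le _ _).trans ?_
        simp only [norm_mul ((b + a - 2 * s : ℝ) : ℂ), norm_mul (((s - a) * (b - s) : ℝ) : ℂ),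
          norm_mul _ Complex.I, Complex.norm_I, mul_one]
        have q0 := mul_le_mul (hpb s hs) b0 (norm_nonneg _) zero_le_one
        have q1 := mul_le_mul (hwt s hs) b1 (norm_nonneg _) zero_le_one
        have : 0 ≤ A * ‖f‖ := by positivity
        simp only [hh, hz]
        linarith
      · intro s hs
        obtain ⟨b0, b1, b2⟩ := hA f _ (hmem τ hτ8 s hs)
        refine (norm_add_le _ _).trans ?_
        refine (add_le_add (norm_add_le _ _) (norm_add_le _ _)).trans ?_
        simp only [norm_mul ((b + a - 2 * s : ℝ) : ℂ), norm_mul (((s - a) * (b - s) : ℝ) : ℂ),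
          norm_mul _ Complex.I, Complex.norm_I, mul_one, norm_mul (-2 : ℂ), norm_neg,
          Complex.norm_ofNat]
        have q1 := mul_le_mul (hpb s hs) b1 (norm_nonneg _) zero_le_one
        have q2 := mul_le_mul (hwt s hs) b2 (norm_nonneg _) zero_le_one
        have : 0 ≤ A * ‖f‖ := by positivity
        simp only [hh, hz]
        linarith
    have h1 := key (W τ n)
    rw [norm_inner_self_eq_norm_sq] at h1
    rcases (norm_nonneg (W τ n)).eq_or_lt with h0 | h0
    · rw [← h0, zero_mul]; positivity
    · have : ‖W τ n‖ * (‖W τ n‖ * (n : ℝ) ^ 2) ≤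
          ‖W τ n‖ * (3 * (5 * A) * Real.exp (n * τ)) := by linarith
      exact le_of_mul_le_mul_left this h0

end EigenFunctionals

/-! ### Starting points of orbits and their orthogonal complement -/

section OrthogonalComplement

open scoped InnerProductSpace

variable {H : Type*} [NormedAddCommGroup H] [InnerProductSpace ℂ H]

/-- The vectors near which there are two-sided orbits, as a subspace. -/
def twoSidedOrbitsNearSubmodule (T : H →L[ℂ] H) (τ₀ : ℝ) : Submodule ℂ H where
  carrier := {v | TwoSidedOrbitsNear T τ₀ v}
  zero_mem' := fun ε hε => ⟨1, one_pos, 0, fun _ _ => 0, fun τ _ => by simpa using hε⟩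
  add_mem' := by
    intro v w hv hw ε hε
    obtain ⟨η, hη, C, W, hW⟩ := hv (ε / 2) (by positivity)
    obtain ⟨η', hη', C', W', hW'⟩ := hw (ε / 2) (by positivity)
    refine ⟨min η η', lt_min hη hη', C + C', fun τ n => W τ n + W' τ n, fun τ hτ => ?_⟩
    obtain ⟨h1, h2⟩ := hW τ (hτ.trans_le (min_le_left _ _))
    obtain ⟨h1', h2'⟩ := hW' τ (hτ.trans_le (min_le_right _ _))
    refine ⟨?_, fun n => ⟨by rw [map_add, (h2 n).1, (h2' n).1], ?_⟩⟩
    · rw [add_sub_add_comm]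
      exact (norm_add_le _ _).trans_lt (by linarith)
    · calc _ ≤ (‖W τ n‖ + ‖W' τ n‖) * (n : ℝ) ^ 2 := by gcongr; exact norm_add_le _ _
        _ ≤ _ := by linarith [(h2 n).2, (h2' n).2]
  smul_mem' := by
    intro c v hv ε hε
    obtain ⟨η, hη, C, W, hW⟩ := hv (ε / (‖c‖ + 1)) (by positivity)
    refine ⟨η, hη, ‖c‖ * C, fun τ n => c • W τ n, fun τ hτ => ?_⟩
    obtain ⟨h1, h2⟩ := hW τ hτ
    refine ⟨?_, fun n => ⟨by rw [map_smul, (h2 n).1], ?_⟩⟩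
    · rw [← smul_sub, norm_smul]
      rw [lt_div_iff₀ (by positivity)] at h1
      nlinarith [norm_nonneg (W τ 0 - v)]
    · rw [norm_smul, mul_assoc, mul_assoc]
      exact mul_le_mul_of_nonneg_left (h2 n).2 (norm_nonneg c)

theorem twoSidedOrbitsNear_of_mem_closure {T : H →L[ℂ] H} {τ₀ : ℝ} {v : H}
    (hv : v ∈ closure {v | TwoSidedOrbitsNear T τ₀ v}) : TwoSidedOrbitsNear T τ₀ v := by
  intro ε hε
  obtain ⟨w, hw, hvw⟩ := Metric.mem_closure_iff.1 hv (ε / 2) (by positivity)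
  obtain ⟨η, hη, C, W, hW⟩ := hw (ε / 2) (by positivity)
  refine ⟨η, hη, C, W, fun τ hτ => ⟨?_, (hW τ hτ).2⟩⟩
  have h1 := (hW τ hτ).1
  rw [dist_comm, dist_eq_norm] at hvw
  linarith [norm_sub_le_norm_sub_add_norm_sub (W τ 0) w v]

variable [CompleteSpace H]

theorem dense_of_forall_inner_eq_zero (S : Submodule ℂ H)
    (h : ∀ f : H, (∀ v ∈ S, ⟪v, f⟫_ℂ = 0) → f = 0) : Dense (S : Set H) := by
  rw [Submodule.dense_iff_topologicalClosure_eq_top, Submodule.topologicalClosure_eq_top_iff,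
    Submodule.eq_bot_iff]
  exact fun f hf => h f fun v hv => Submodule.inner_right_of_mem_orthogonal hv hf

/-- A vector orthogonal to all two-sided orbits is annihilated by every holomorphic family of
eigenfunctionals. -/
theorem eq_zero_of_orthogonal_twoSidedOrbitsNear {K : ℂ → H →L[ℂ] ℂ} {ζ₀ : ℂ} {r : ℝ}
    (M : H →L[ℂ] H) (hr : 0 < r)
    (hd : ∀ f, DifferentiableOn ℂ (fun ζ => K ζ f) (Metric.ball ζ₀ r))
    (hK : ∀ ζ ∈ Metric.ball ζ₀ r, ∀ f, K ζ (M f) = Complex.exp ζ * K ζ f) {f : H}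
    (hf : ∀ v, TwoSidedOrbitsNear (ContinuousLinearMap.adjoint M) ζ₀.re v → ⟪v, f⟫_ℂ = 0) :
    ∀ ζ ∈ Metric.ball ζ₀ r, K ζ f = 0 := by
  set ρ := min (r / 8) (1 / 2) with hρ
  have hρ0 : 0 < ρ := by positivity
  have hρ1 : ρ ≤ r / 8 := min_le_left _ _
  have hρ2 : ρ ≤ 1 / 2 := min_le_right _ _
  set z : ℝ → ℂ := fun s => ζ₀.re + s * Complex.I with hz
  have hzc : Continuous z := by fun_prop
  have hzball : ∀ s, |s - ζ₀.im| < ρ → z s ∈ Metric.ball ζ₀ r := by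
    intro s hs
    have := add_mul_I_mem_closedBall (ζ₀ := ζ₀) (τ := ζ₀.re) (s := s) (ρ := ρ)
      (by rw [sub_self, abs_zero]; exact hρ0.le) hs.le
    exact Metric.closedBall_subset_ball (by linarith) this
  -- If the value at `s₀` were nonzero, then after rotation its real part would be positive on a
  -- short interval, and so would the weighted integral there; but orthogonality makes that integral
  -- zero.
  have hline : ∀ s, |s - ζ₀.im| < ρ → K (z s) f = 0 := by
    intro s₀ hs₀
    by_contra hne
    set g : ℝ → ℂ := fun s => K (z s) f with hg
    have hgc : ∀ s, |s - ζ₀.im| < ρ → ContinuousAt g s := fun s hs =>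
      ContinuousAt.comp (f := z) (g := fun ζ => K ζ f)
        ((hd f).continuousOn.continuousAt (Metric.isOpen_ball.mem_nhds (hzball s hs)))
        hzc.continuousAt
    set q : ℝ → ℝ := fun s => (star (g s₀) * g s).re with hq
    have hqc : ∀ s, |s - ζ₀.im| < ρ → ContinuousAt q s := fun s hs =>
      Complex.continuous_re.continuousAt.comp (continuousAt_const.mul (hgc s hs))
    have hq0 : 0 < q s₀ := by
      have : q s₀ = Complex.normSq (g s₀) := by
        simp only [hq, Complex.star_def, ← Complex.normSq_eq_conj_mul_self, Complex.ofReal_re]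
      rw [this]
      exact Complex.normSq_pos.2 hne
    have hnear : ∀ᶠ s in 𝓝 s₀, 0 < q s ∧ |s - ζ₀.im| < ρ := by
      refine ((hqc s₀ hs₀).eventually (lt_mem_nhds hq0)).and ?_
      have : Continuous fun s : ℝ => |s - ζ₀.im| := by fun_prop
      exact (this.tendsto s₀).eventually (gt_mem_nhds hs₀)
    obtain ⟨e, he, hball⟩ := Metric.eventually_nhds_iff_ball.1 hnear
    set a := s₀ - e / 2
    set b := s₀ + e / 2
    have hab : a < b := by simp only [a, b]; linarith
    have hIcc : ∀ s ∈ Set.Icc a b, 0 < q s ∧ |s - ζ₀.im| < ρ := by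
      intro s hs
      refine hball s ?_
      rw [Metric.mem_ball, Real.dist_eq, abs_lt]
      simp only [a, b, Set.mem_Icc] at hs
      constructor <;> linarith [hs.1, hs.2]
    have ha := abs_lt.1 (hIcc a (Set.left_mem_Icc.2 hab.le)).2
    have hb := abs_lt.1 (hIcc b (Set.right_mem_Icc.2 hab.le)).2
    obtain ⟨v, hv, hvf⟩ := exists_twoSidedOrbitsNear_adjoint M hr hd hK hab.le
      (by linarith) (by linarith) (by linarith)
    have h0 := hvf f
    rw [hf v hv] at h0
    have hgon : ContinuousOn g (Set.uIcc a b) := by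
      rw [Set.uIcc_of_le hab.le]
      exact fun s hs => (hgc s (hIcc s hs).2).continuousWithinAt
    have hp : Continuous fun s : ℝ => (((s - a) * (b - s) : ℝ) : ℂ) := by fun_prop
    have hint : IntervalIntegrable (fun s => star (g s₀) * ((((s - a) * (b - s) : ℝ) : ℂ) * g s))
        MeasureTheory.volume a b :=
      (continuousOn_const.mul (hp.continuousOn.mul hgon)).intervalIntegrable
    have hre := Complex.reCLM.intervalIntegral_comp_comm hint
    rw [intervalIntegral.integral_const_mul] at hre
    have h0' : ∫ s in a..b, (((s - a) * (b - s) : ℝ) : ℂ) * g s = 0 := h0.symm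
    rw [h0', mul_zero, map_zero] at hre
    have hpos : 0 < ∫ s in a..b,
        Complex.reCLM (star (g s₀) * ((((s - a) * (b - s) : ℝ) : ℂ) * g s)) := by
      refine intervalIntegral.intervalIntegral_pos_of_pos_on ?_ (fun s hs => ?_) hab
      · exact (Complex.continuous_re.comp_continuousOn
          (continuousOn_const.mul (hp.continuousOn.mul hgon))).intervalIntegrable
      · have e1 : star (g s₀) * ((((s - a) * (b - s) : ℝ) : ℂ) * g s) =
            (((s - a) * (b - s) : ℝ) : ℂ) * (star (g s₀) * g s) := by ring
        rw [e1, Complex.reCLM_apply, Complex.re_ofReal_mul]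
        exact mul_pos (mul_pos (by linarith [hs.1]) (by linarith [hs.2]))
          (hIcc s ⟨hs.1.le, hs.2.le⟩).1
    exact hpos.ne' hre
  have hζ : z ζ₀.im = ζ₀ := by simp [hz]
  -- Zeros on a vertical segment accumulate at `ζ₀`, so the identity theorem applies.
  have hfreq : ∃ᶠ ζ in 𝓝[≠] ζ₀, K ζ f = 0 := by
    have ht : Tendsto z (𝓝[≠] ζ₀.im) (𝓝[≠] ζ₀) := by
      refine tendsto_nhdsWithin_iff.2 ⟨?_, ?_⟩
      · have := hzc.tendsto ζ₀.im
        rw [hζ] at this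
        exact this.mono_left nhdsWithin_le_nhds
      · filter_upwards [self_mem_nhdsWithin] with s hs
        intro h
        apply hs
        have := congrArg Complex.im (Set.mem_singleton_iff.1 h)
        simpa [hz] using this
    refine ht.frequently (Eventually.frequently ?_)
    refine nhdsWithin_le_nhds ?_
    have : Continuous fun s : ℝ => |s - ζ₀.im| := by fun_prop
    have h1 := this.tendsto ζ₀.im
    rw [sub_self, abs_zero] at h1
    filter_upwards [h1.eventually (gt_mem_nhds hρ0)] with s hs using hline s hs
  exact ((hd f).analyticOnNhd Metric.isOpen_ball).eqOn_zero_of_preconnected_of_frequently_eq_zero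
    (convex_ball ζ₀ r).isPreconnected (Metric.mem_ball_self hr) hfreq

end OrthogonalComplement

/-! ### Evaluations, kernels and multipliers -/

section FunctionHilbert

open scoped InnerProductSpace

variable {m : ℕ} {U : Opens (Fin m → ℂ)}

theorem extend_zero_apply (f : U → ℂ) {p : Fin m → ℂ} (hp : p ∈ U) :
    Function.extend Subtype.val f 0 p = f ⟨p, hp⟩ :=
  Subtype.val_injective.extend_apply f 0 ⟨p, hp⟩

variable {H : Type*} [NormedAddCommGroup H] [InnerProductSpace ℂ H] [RKHS ℂ H U ℂ]

variable (H U) in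
/-- Evaluation at a point of `ℂᵐ`, zero outside `U`. -/
noncomputable def evalExtend (p : Fin m → ℂ) : H →L[ℂ] ℂ :=
  open scoped Classical in
  if hp : p ∈ U then
    (ContinuousLinearMap.proj (R := ℂ) (φ := fun _ : U => ℂ) (⟨p, hp⟩ : U)).comp (RKHS.coeCLM ℂ)
  else 0

theorem evalExtend_apply {p : Fin m → ℂ} (hp : p ∈ U) (f : H) :
    evalExtend U H p f = f ⟨p, hp⟩ := by
  simp [evalExtend, hp]

theorem differentiableOn_evalExtend [FunctionHilbertSpace U H] (f : H) :
    DifferentiableOn ℂ (fun p => evalExtend U H p f) U := by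
  intro p hp
  have h : DifferentiableAt ℂ (Function.extend Subtype.val (f : U → ℂ) 0) p :=
    FunctionHilbertSpace.holomorphic f ⟨p, hp⟩
  refine (h.differentiableWithinAt).congr (fun q hq => ?_) ?_
  · rw [evalExtend_apply hq, extend_zero_apply _ hq]
  · rw [evalExtend_apply hp, extend_zero_apply _ hp]

theorem eq_zero_of_evalExtend_eq_zero {f : H} (h : ∀ p ∈ U, evalExtend U H p f = 0) : f = 0 := by
  refine RKHS.ext fun x => ?_
  rw [← evalExtend_apply x.2, h x x.2]
  simp

theorem eq_zero_of_eventually_evalExtend_eq_zero [FunctionHilbertSpace U H]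
    (hU : IsConnected (U : Set (Fin m → ℂ))) {f : H} {p : Fin m → ℂ} (hp : p ∈ U)
    (h : ∀ᶠ q in 𝓝 p, evalExtend U H q f = 0) : f = 0 :=
  eq_zero_of_evalExtend_eq_zero ((differentiableOn_evalExtend f).eqOn_zero_of_eventuallyEq_zero
    U.isOpen hU.isPreconnected hp h)

theorem inner_kerFun_one [CompleteSpace H] (x : U) (f : H) :
    ⟪RKHS.kerFun H x (1 : ℂ), f⟫_ℂ = f x := by
  rw [RKHS.kerFun_inner]
  simp

/-- Kernels at a countable dense set of points span a dense subspace, because elements of `H` are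
continuous. The Baire argument needs the resulting countable basis. -/
theorem secondCountableTopology_of_functionHilbertSpace [FunctionHilbertSpace U H] :
    SecondCountableTopology H := by
  obtain ⟨s, hsc, hsd⟩ := exists_countable_dense U
  set S := Submodule.span ℂ ((fun x : U => RKHS.kerFun H x (1 : ℂ)) '' s)
  have hS : Dense (S : Set H) := by
    refine dense_of_forall_inner_eq_zero S fun f hf => RKHS.ext fun x => ?_
    have hcont : Continuous (f : U → ℂ) := by
      have h1 : ContinuousOn (fun p => evalExtend U H p f) U :=
        (differentiableOn_evalExtend f).continuousOn
      have h2 := continuousOn_iff_continuous_domRestrict.1 h1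
      refine h2.congr fun x => ?_
      exact evalExtend_apply x.2 f
    have h0 : (f : U → ℂ) = fun _ => 0 := by
      refine hcont.ext_on hsd continuous_const fun x hx => ?_
      rw [← inner_kerFun_one]
      exact hf _ (Submodule.subset_span ⟨x, hx, rfl⟩)
    simpa using congrFun h0 x
  have hsep : IsSeparable (S : Set H) := (hsc.image _).isSeparable.span
  have : SeparableSpace H := by
    rw [← isSeparable_univ_iff, ← hS.closure_eq]
    exact hsep.closure
  exact UniformSpace.secondCountable_of_separable H

variable {φ : U → ℂ} [FunctionHilbertSpace U H]

theorem evalExtend_mulOp (hφ : IsMultiplier H φ) {p : Fin m → ℂ} (hp : p ∈ U) (f : H) :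
    evalExtend U H p (mulOp hφ f) =
      Function.extend Subtype.val φ 0 p * evalExtend U H p f := by
  rw [evalExtend_apply hp, evalExtend_apply hp, extend_zero_apply _ hp, mulOp_apply]

/-- Near a point where some `f ∈ H` is nonzero, `φ` is the quotient `(φ f) / f`. -/
theorem differentiableOn_extend_multiplier (hφ : IsMultiplier H φ)
    (hφ_zeros : ∀ z : U, (∀ f : H, f z = 0) → HolAt φ z) :
    DifferentiableOn ℂ (Function.extend Subtype.val φ 0) U := by
  intro p hp
  by_cases h : ∀ f : H, f ⟨p, hp⟩ = 0
  · exact DifferentiableAt.differentiableWithinAt (hφ_zeros ⟨p, hp⟩ h)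
  · push Not at h
    obtain ⟨f, hf⟩ := h
    rw [← evalExtend_apply hp] at hf
    have hd : ∀ g : H, DifferentiableAt ℂ (fun q => evalExtend U H q g) p := fun g =>
      (differentiableOn_evalExtend g).differentiableAt (U.isOpen.mem_nhds hp)
    refine DifferentiableAt.differentiableWithinAt
      (((hd (mulOp hφ f)).mul ((hd f).inv hf)).congr_of_eventuallyEq ?_)
    filter_upwards [(hd f).continuousAt.eventually_ne hf, U.isOpen.mem_nhds hp] with q hq hqU
    simp only [Pi.mul_apply, Pi.inv_apply]
    rw [evalExtend_mulOp hφ hqU, mul_inv_cancel_right₀ hq]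

variable (hφ : IsMultiplier H φ)

theorem adjointMulOp_kerFun (x : U) :
    adjointMulOp hφ (RKHS.kerFun H x (1 : ℂ)) = star (φ x) • RKHS.kerFun H x (1 : ℂ) := by
  refine ext_inner_right ℂ fun f => ?_
  rw [adjointMulOp, ContinuousLinearMap.adjoint_inner_left, inner_smul_left, inner_kerFun_one,
    inner_kerFun_one, mulOp_apply]
  simp

/-- If `φ` is small somewhere, then orbits of the adjoint grow slowly on a dense set. -/
theorem dense_setOf_norm_adjointMulOp_pow_le (hU : IsConnected (U : Set (Fin m → ℂ)))
    (hφd : DifferentiableOn ℂ (Function.extend Subtype.val φ 0) U) {α : ℝ} {x : U}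
    (hx : ‖φ x‖ < Real.exp α) :
    Dense {u : H | ∃ C : ℝ, ∀ n : ℕ, ‖(adjointMulOp hφ ^ n) u‖ ≤ C * Real.exp (n * α)} := by
  let S : Submodule ℂ H :=
    { carrier := {u : H | ∃ C : ℝ, ∀ n : ℕ, ‖(adjointMulOp hφ ^ n) u‖ ≤ C * Real.exp (n * α)}
      zero_mem' := ⟨0, fun n => by simp⟩
      add_mem' := by
        rintro u v ⟨C, hC⟩ ⟨C', hC'⟩
        refine ⟨C + C', fun n => ?_⟩
        rw [map_add, add_mul]
        exact (norm_add_le _ _).trans (add_le_add (hC n) (hC' n))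
      smul_mem' := by
        rintro c u ⟨C, hC⟩
        refine ⟨‖c‖ * C, fun n => ?_⟩
        rw [map_smul, norm_smul, mul_assoc]
        exact mul_le_mul_of_nonneg_left (hC n) (norm_nonneg c) }
  -- Kernels at points near `x` are eigenvectors with eigenvalue of modulus less than `exp α`; a
  -- function orthogonal to them vanishes near `x`.
  refine dense_of_forall_inner_eq_zero S fun f hf => ?_
  refine eq_zero_of_eventually_evalExtend_eq_zero hU x.2 ?_
  have hc : ContinuousAt (Function.extend Subtype.val φ 0) (x : Fin m → ℂ) :=
    (hφd.differentiableAt (U.isOpen.mem_nhds x.2)).continuousAt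
  have hlt : ‖Function.extend Subtype.val φ 0 (x : Fin m → ℂ)‖ < Real.exp α := by
    rwa [extend_zero_apply _ x.2]
  filter_upwards [hc.norm.eventually (gt_mem_nhds hlt), U.isOpen.mem_nhds x.2] with q hq hqU
  rw [extend_zero_apply _ hqU] at hq
  rw [evalExtend_apply hqU, ← inner_kerFun_one]
  refine hf _ ⟨‖RKHS.kerFun H (⟨q, hqU⟩ : U) (1 : ℂ)‖, fun n => ?_⟩
  have hpow : (adjointMulOp hφ ^ n) (RKHS.kerFun H (⟨q, hqU⟩ : U) (1 : ℂ)) =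
      star (φ ⟨q, hqU⟩) ^ n • RKHS.kerFun H (⟨q, hqU⟩ : U) (1 : ℂ) := by
    induction n with
    | zero => simp
    | succ n ih =>
      rw [pow_succ', mul_apply_eq_comp, ih, map_smul, adjointMulOp_kerFun, smul_smul, pow_succ]
  rw [hpow, norm_smul, norm_pow, norm_star, mul_comm, Real.exp_nat_mul]
  gcongr

/-- The point `x` may be critical for `φ`, so the argument restricts to a complex line through `x`
on which `φ` is not constant and moves to a non-critical point of that line with the same modulus.
An `f` orthogonal to all starting points vanishes near that point on the line, hence along the line
inside the ball. Such lines cover an open set. -/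
theorem twoSidedOrbitsNear_adjointMulOp (hU : IsConnected (U : Set (Fin m → ℂ)))
    (hφd : DifferentiableOn ℂ (Function.extend Subtype.val φ 0) U)
    (hφ_nonconst : ∃ z w : U, φ z ≠ φ w) {τ₀ : ℝ} {x : U} (hx : ‖φ x‖ = Real.exp τ₀) (v : H) :
    TwoSidedOrbitsNear (adjointMulOp hφ) τ₀ v := by
  set Φ : (Fin m → ℂ) → ℂ := Function.extend Subtype.val φ 0 with hΦ
  have hΦx : ‖Φ x‖ = Real.exp τ₀ := by rwa [hΦ, extend_zero_apply _ x.2]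
  have hΦ0 : Φ x ≠ 0 := by
    intro h
    rw [h, norm_zero] at hΦx
    exact (Real.exp_pos τ₀).ne hΦx
  have hdense : Dense (twoSidedOrbitsNearSubmodule (adjointMulOp hφ) τ₀ : Set H) := by
    refine dense_of_forall_inner_eq_zero _ fun f hf => ?_
    obtain ⟨r, hr, hball⟩ := Metric.isOpen_iff.1 U.isOpen x x.2
    have key : ∀ w ∈ Metric.ball (x : Fin m → ℂ) r, Φ w ≠ Φ x → evalExtend U H w f = 0 := by
      intro w hw hne
      set ℓ : ℂ → (Fin m → ℂ) := fun t => (x : Fin m → ℂ) + t • (w - x) with hℓ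
      have hℓd : Differentiable ℂ ℓ := by fun_prop
      set O : Set ℂ := ℓ ⁻¹' Metric.ball (x : Fin m → ℂ) r with hO
      have hOo : IsOpen O := Metric.isOpen_ball.preimage hℓd.continuous
      have hOc : IsPreconnected O := (convex_line_preimage_ball _ _ _ r).isPreconnected
      have hℓ0 : ℓ 0 = x := by simp [hℓ]
      have hℓ1 : ℓ 1 = w := by simp [hℓ]
      have h0O : (0 : ℂ) ∈ O := by rw [hO, Set.mem_preimage, hℓ0]; exact Metric.mem_ball_self hr
      have h1O : (1 : ℂ) ∈ O := by rw [hO, Set.mem_preimage, hℓ1]; exact hw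
      have hg : AnalyticOnNhd ℂ (Φ ∘ ℓ) O :=
        (hφd.comp hℓd.differentiableOn fun t ht => hball ht).analyticOnNhd hOo
      obtain ⟨t₀, ht₀, hnorm, hder⟩ := exists_norm_eq_and_deriv_ne_zero hg hOo hOc h0O h1O
        (by simpa [hℓ0, hℓ1] using hne) (by simpa [hℓ0] using hΦ0)
      rw [Function.comp_apply, Function.comp_apply, hℓ0, hΦx] at hnorm
      have hg0 : (Φ ∘ ℓ) t₀ ≠ 0 := by
        intro h
        rw [Function.comp_apply] at h
        rw [h, norm_zero] at hnorm
        exact (Real.exp_pos τ₀).ne hnorm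
      obtain ⟨ζ₀, ρ, ψ, hζ₀, hρ, hψd, hψ, hψev⟩ :=
        exists_local_section_exp hOo ht₀ (hg t₀ ht₀) hg0 hder
      have hre : ζ₀.re = τ₀ := by
        rw [Function.comp_apply] at hζ₀
        rw [← hζ₀, Complex.norm_exp] at hnorm
        exact Real.exp_injective hnorm
      -- Along the section `ψ` the value of `φ` is `e^ζ`, so evaluation at `ℓ (ψ ζ)` is an
      -- eigenfunctional of `M_φ`.
      have hzero := eq_zero_of_orthogonal_twoSidedOrbitsNear
        (K := fun ζ => evalExtend U H (ℓ (ψ ζ))) (ζ₀ := ζ₀) (r := ρ) (mulOp hφ) hρ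
        (fun g => (differentiableOn_evalExtend g).comp
          (hℓd.differentiableOn.comp hψd (Set.mapsTo_univ _ _)) fun ζ hζ => hball (hψ ζ hζ).1)
        (fun ζ hζ g => by
          rw [evalExtend_mulOp hφ (hball (hψ ζ hζ).1), ← (hψ ζ hζ).2]; rfl)
        (f := f) (fun v hv => hf v (by rw [hre] at hv; exact hv))
      have hFd : AnalyticOnNhd ℂ ((fun p => evalExtend U H p f) ∘ ℓ) O :=
        ((differentiableOn_evalExtend f).comp hℓd.differentiableOn
          fun t ht => hball ht).analyticOnNhd hOo
      have hFev : (fun p => evalExtend U H p f) ∘ ℓ =ᶠ[𝓝 t₀] 0 := by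
        filter_upwards [hψev] with t ht
        obtain ⟨ζ, hζ, rfl⟩ := ht
        exact hzero ζ hζ
      have := hFd.eqOn_zero_of_preconnected_of_eventuallyEq_zero hOc ht₀ hFev h1O
      simpa [hℓ1] using this
    obtain ⟨q, hq, hqne⟩ : ∃ q ∈ Metric.ball (x : Fin m → ℂ) r, Φ q ≠ Φ x := by
      by_contra! hcon
      have hconst := (hφd.sub_const (Φ x)).eqOn_zero_of_eventuallyEq_zero U.isOpen
        hU.isPreconnected x.2 (Filter.mem_of_superset (Metric.ball_mem_nhds _ hr)
          fun q hq => sub_eq_zero.2 (hcon q hq))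
      obtain ⟨z, w, hzw⟩ := hφ_nonconst
      apply hzw
      have hz := sub_eq_zero.1 (hconst z z.2)
      have hw := sub_eq_zero.1 (hconst w w.2)
      rw [hΦ, extend_zero_apply _ z.2] at hz
      rw [hΦ, extend_zero_apply _ w.2] at hw
      exact hz.trans hw.symm
    refine eq_zero_of_eventually_evalExtend_eq_zero hU (hball hq) ?_
    have hc : ContinuousAt Φ q :=
      (hφd.differentiableAt (U.isOpen.mem_nhds (hball hq))).continuousAt
    filter_upwards [hc.eventually_ne hqne, Metric.isOpen_ball.mem_nhds hq] with w hw hwb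
      using key w hwb hw
  exact twoSidedOrbitsNear_of_mem_closure (hdense v)

end FunctionHilbert

/-! ### Conclusion -/

theorem mainTheorem7 {m : ℕ} (U : Opens (Fin m → ℂ)) (hU : IsConnected (U : Set (Fin m → ℂ)))
    {H : Type*} [NormedAddCommGroup H] [InnerProductSpace ℂ H] [RKHS ℂ H U ℂ]
    [FunctionHilbertSpace U H]
    (φ : U → ℂ) (hφ : IsMultiplier H φ)
    -- holomorphy of `φ` is automatic off the common zeros of `H`
    (hφ_zeros : ∀ z : U, (∀ f : H, f z = 0) → HolAt φ z)
    (hφ_nonconst : ∃ z w : U, φ z ≠ φ w)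
    (a b : ℝ≥0∞) (ha : a = ⨅ z : U, ‖φ z‖ₑ) (hb : b = ⨆ z : U, ‖φ z‖ₑ) :
    IsGδ (commonHypercyclicVectors
      {T : H →L[ℂ] H | ∃ z : ℂ, b⁻¹ < ‖z‖ₑ ∧ ‖z‖ₑ < a⁻¹ ∧ T = z • adjointMulOp hφ}) ∧
    Dense (commonHypercyclicVectors
      {T : H →L[ℂ] H | ∃ z : ℂ, b⁻¹ < ‖z‖ₑ ∧ ‖z‖ₑ < a⁻¹ ∧ T = z • adjointMulOp hφ}) := by
  have hφd := differentiableOn_extend_multiplier hφ hφ_zeros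
  have := secondCountableTopology_of_functionHilbertSpace (U := U) (H := H)
  have hA : IsOpen {z : ℂ | b⁻¹ < ‖z‖ₑ ∧ ‖z‖ₑ < a⁻¹} :=
    (isOpen_lt continuous_const continuous_enorm).inter
      (isOpen_lt continuous_enorm continuous_const)
  have hset : {T : H →L[ℂ] H | ∃ z : ℂ, b⁻¹ < ‖z‖ₑ ∧ ‖z‖ₑ < a⁻¹ ∧ T = z • adjointMulOp hφ} =
      {T : H →L[ℂ] H | ∃ z ∈ {z : ℂ | b⁻¹ < ‖z‖ₑ ∧ ‖z‖ₑ < a⁻¹}, T = z • adjointMulOp hφ} := by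
    ext T
    simp only [Set.mem_ofPred_eq, and_assoc]
  rw [hset]
  refine isGδ_dense_commonHypercyclicVectors _ hA fun V hV hne z hz => ?_
  obtain ⟨hzb, hza⟩ := hz
  have hz0 : z ≠ 0 := by
    rintro rfl
    simp at hzb
  have hzpos : 0 < ‖z‖ := norm_pos_iff.2 hz0
  set τ₀ := -Real.log ‖z‖ with hτ₀
  have hexp : ‖z⁻¹‖ = Real.exp τ₀ := by
    rw [hτ₀, Real.exp_neg, Real.exp_log hzpos, norm_inv]
  have hinv : ‖z⁻¹‖ₑ = ‖z‖ₑ⁻¹ := enorm_inv hz0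
  obtain ⟨y, hy⟩ : ∃ y : U, ‖z⁻¹‖ₑ < ‖φ y‖ₑ := by
    rw [← lt_iSup_iff, ← hb, hinv]
    exact ENNReal.inv_lt_iff_inv_lt.1 hzb
  obtain ⟨x, hx⟩ : ∃ x : U, ‖φ x‖ₑ < ‖z⁻¹‖ₑ := by
    rw [← iInf_lt_iff, ← ha, hinv]
    exact ENNReal.lt_inv_iff_lt_inv.1 hza
  rw [← ofReal_norm, ← ofReal_norm, ENNReal.ofReal_lt_ofReal_iff_of_nonneg (norm_nonneg _), hexp] at hy hx
  have hcont : ContinuousOn (fun p => ‖Function.extend Subtype.val φ 0 p‖) U :=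
    hφd.continuousOn.norm
  -- `|φ|` takes values below and above `1 / |z|`, so on the connected set `U` it attains `1 / |z| =
  -- exp τ₀`. The smaller value also leaves room for `α < τ₀`.
  obtain ⟨p, hpU, hp⟩ : ∃ p ∈ (U : Set (Fin m → ℂ)),
      ‖Function.extend Subtype.val φ 0 p‖ = Real.exp τ₀ := by
    refine hU.isPreconnected.intermediate_value x.2 y.2 hcont ⟨?_, ?_⟩
    · rw [extend_zero_apply _ x.2]; exact hx.le
    · rw [extend_zero_apply _ y.2]; exact hy.le
  rw [extend_zero_apply _ hpU] at hp
  obtain ⟨α, hα, hxα⟩ : ∃ α < τ₀, ‖φ x‖ < Real.exp α := by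
    have h1 : ∀ᶠ α in 𝓝[<] τ₀, ‖φ x‖ < Real.exp α :=
      nhdsWithin_le_nhds ((Real.continuous_exp.tendsto τ₀).eventually (lt_mem_nhds hx))
    obtain ⟨α, h1, h2⟩ := (h1.and self_mem_nhdsWithin).exists
    exact ⟨α, h2, h1⟩
  obtain ⟨η, hη, hdense⟩ := dense_setOf_forall_exists_smul_pow_mem (adjointMulOp hφ)
    (twoSidedOrbitsNear_adjointMulOp hφ hU hφd hφ_nonconst (x := ⟨p, hpU⟩) hp)
    (dense_setOf_norm_adjointMulOp_pow_le hφ hU hφd hxα) hα (fun u hu => hu) hV hne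
  have hlog : Tendsto (fun w : ℂ => |Real.log ‖w‖ + τ₀|) (𝓝 z) (𝓝 0) := by
    have h1 : ContinuousAt (fun w : ℂ => |Real.log ‖w‖ + τ₀|) z :=
      ((continuous_norm.continuousAt.log hzpos.ne').add continuousAt_const).abs
    have h2 : |Real.log ‖z‖ + τ₀| = 0 := by rw [hτ₀, add_neg_cancel, abs_zero]
    rw [← h2]
    exact h1
  refine ⟨{w | w ≠ 0 ∧ |Real.log ‖w‖ + τ₀| < η},
    (eventually_ne_nhds hz0).and (hlog.eventually (gt_mem_nhds hη)), ?_⟩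
  refine hdense.mono fun u hu w hw => ?_
  exact (show ∀ w : ℂ, w ≠ 0 → |Real.log ‖w‖ + τ₀| < η →
    ∃ n : ℕ, ((w • adjointMulOp hφ) ^ n) u ∈ V from hu) w hw.1 hw.2
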